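/- Let $\mathcal B$ be a $C^*$-algebra, let $E$ be a $C^*$-correspondence over $\mathcal B$ (a right Hilbert $\mathcal B$-module with a nondegenerate left action $\phi:\mathcal B\to\mathcal L(E)$ by adjointable operators), and let $(\sigma,V)$ be a completely bounded covariant representation of $E$ on a Hilbert space $\mathcal H$: $\sigma:\mathcal B\to B(\mathcal H)$ is a nondegenerate $*$-representation and $V:E\to B(\mathcal H)$ is a completely bounded linear map with $V(b\xi c)=\sigma(b)V(\xi)\sigma(c)$ for $b,c\in\mathcal B$, $\xi\in E$. Let $\widetilde V:E\otimes_\sigma\mathcal H\to\mathcal H$ be the bounded operator with $\widetilde V(\xi\otimes h)=V(\xi)h$. For a bounded operator $W:E\otimes_\sigma\mathcal H\to\mathcal H$ with $W(\phi(b)\otimes I)=\sigma(b)W$ for all $b\in\mathcal B$, let $W_0=I_{\mathcal H}$ and $W_{n+1}=W_n(I_{E^{\otimes n}}\otimes W):E^{\otimes (n+1)}\otimes\mathcal H\to\mathcal H$, let $R^\infty(W)=\bigcap_{n\ge0}R(W_n)$, and for a closed $\sigma(\mathcal B)$-invariant subspace $\mathcal K$ of $\mathcal H$ let $[\mathcal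 K]_W=\bigvee_{n\ge0}W_n(E^{\otimes n}\otimes\mathcal K)$ (closed linear span). Here $R$ and $N$ denote range and kernel, and $E^{\otimes 0}\otimes\mathcal H=\mathcal H$. Suppose that $(\sigma,V)$ is bi-regular, that is, $R(\widetilde V)$ is closed, $N(\widetilde V)\subseteq E\otimes R^\infty(\widetilde V)$, and $N(I_{E^{\otimes n}}\otimes\widetilde V^\dagger)\subseteq R(\widetilde V^{\dagger(n)})$ for all $n\ge1$, where $\widetilde V^\dagger$ is the Moore–Penrose inverse of $\widetilde V$ and $\widetilde V^{\dagger(n)}=(I_{E^{\otimes (n-1)}}\otimes\widetilde V^\dagger)\cdots(I_E\otimes\widetilde V^\dagger)\widetilde V^\dagger$. Let $\widetilde V'=\widetilde V(\widetilde V^*\widetilde V)^\dagger$ be the operator of the Cauchy dual $(\sigma,V')$ and let $\mathcal E=\mathcal H\ominus R(\widetilde V)$. Then, as orthogonal direct sums, $$\mathcal H=[\mathcal E]_{\widetilde V}\oplus R^\infty(\widetilde V')=[\mathcal E]_{\widetilde V'}\oplus R^\infty(\widetilde V).$$ -/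

import Mathlib

open scoped TensorProduct ComplexOrder InnerProductSpace

universe u v

set_option linter.unusedSectionVars false

namespace CovariantRep

section Module

lemma exists_eq_star_mul_self {A : Type*} [NonUnitalCStarAlgebra A] [PartialOrder A]
    [StarOrderedRing A] {a : A} (ha : 0 ≤ a) : ∃ d : A, a = star d * d :=
  CStarAlgebra.nonneg_iff_eq_star_mul_self.1 ha

lemma exists_conj_eq_neg {A : Type*} [NonUnitalCStarAlgebra A] [PartialOrder A] [StarOrderedRing A]
    (G : A) (hG : IsSelfAdjoint G) :
    ∃ m c : A, star m * G * m = -(star c * c) ∧ (c = 0 → 0 ≤ G) := by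
  have hm : 0 ≤ G⁻ := CFC.negPart_nonneg G
  have hmsa : star G⁻ = G⁻ := (IsSelfAdjoint.of_nonneg hm).star_eq
  have hpos : 0 ≤ G⁻ * G⁻ * G⁻ := conjugate_nonneg_of_nonneg hm hm
  obtain ⟨c, hc⟩ := CStarAlgebra.nonneg_iff_eq_star_mul_self.1 hpos
  refine ⟨G⁻, c, ?_, fun h => ?_⟩
  · rw [hmsa, ← hc]
    conv_lhs => enter [1, 2]; rw [← CFC.posPart_sub_negPart G hG]
    rw [mul_sub, CFC.negPart_mul_posPart, zero_sub, neg_mul]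
  · rw [h, mul_zero] at hc
    have h2 : G⁻ * G⁻ = 0 := by
      rw [← CStarRing.star_mul_self_eq_zero_iff, star_mul, hmsa, mul_assoc, ← mul_assoc G⁻ G⁻ G⁻,
        hc, mul_zero]
    have h3 : G⁻ = 0 := by
      rw [← CStarRing.star_mul_self_eq_zero_iff, hmsa, h2]
    exact (CFC.negPart_eq_zero_iff G hG).1 h3

variable {B : Type u} [NonUnitalCStarAlgebra B] [PartialOrder B]
variable {E : Type v} [NormedAddCommGroup E] [NormedSpace ℂ E] [SMul Bᵐᵒᵖ E] [CStarModule Bᵐᵒᵖ E]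

/-- A right Hilbert `B`-module `E` is encoded as a Hilbert C⋆-module over `Bᵐᵒᵖ` (the right
multiplication `ξ b` being `MulOpposite.op b • ξ`). This is its `B`-valued inner product, which is
conjugate-linear in the first and linear in the second variable. -/
def rinner (B : Type u) [NonUnitalCStarAlgebra B] [PartialOrder B]
    {E : Type v} [NormedAddCommGroup E] [NormedSpace ℂ E] [SMul Bᵐᵒᵖ E] [CStarModule Bᵐᵒᵖ E]
    (ξ η : E) : B := MulOpposite.unop (inner Bᵐᵒᵖ ξ η)

lemma rinner_add_right (ξ η ζ : E) : rinner B ξ (η + ζ) = rinner B ξ η + rinner B ξ ζ := by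
  simp [rinner]

lemma rinner_add_left (ξ η ζ : E) : rinner B (ξ + η) ζ = rinner B ξ ζ + rinner B η ζ := by
  simp [rinner]

lemma rinner_smul_right (z : ℂ) (ξ η : E) : rinner B ξ (z • η) = z • rinner B ξ η := by
  simp [rinner]

lemma rinner_smul_left (z : ℂ) (ξ η : E) : rinner B (z • ξ) η = star z • rinner B ξ η := by
  simp [rinner]

lemma star_rinner (ξ η : E) : star (rinner B ξ η) = rinner B η ξ := by
  simp only [rinner, ← MulOpposite.unop_star, CStarModule.star_inner]

lemma rinner_op_right (b : B) (ξ η : E) :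
    rinner B ξ (MulOpposite.op b • η) = rinner B ξ η * b := by
  simp [rinner]

lemma rinner_op_left (b : B) (ξ η : E) :
    rinner B (MulOpposite.op b • ξ) η = star b * rinner B ξ η := by
  simp [rinner]

lemma rinner_self_nonneg (ξ : E) : 0 ≤ rinner B ξ ξ :=
  CStarModule.inner_self_nonneg (A := Bᵐᵒᵖ) (x := ξ)

lemma norm_rinner_self (ξ : E) : ‖rinner B ξ ξ‖ = ‖ξ‖ ^ 2 :=
  (CStarModule.norm_sq_eq Bᵐᵒᵖ (x := ξ)).symm

lemma rinner_sum_right {ι : Type*} (s : Finset ι) (ξ : E) (η : ι → E) :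
    rinner B ξ (∑ i ∈ s, η i) = ∑ i ∈ s, rinner B ξ (η i) := by
  simp [rinner, CStarModule.inner_sum_right]

lemma rinner_sum_left {ι : Type*} (s : Finset ι) (ξ : ι → E) (η : E) :
    rinner B (∑ i ∈ s, ξ i) η = ∑ i ∈ s, rinner B (ξ i) η := by
  simp [rinner, CStarModule.inner_sum_left]

lemma rinner_ext {ξ ζ : E} (h : ∀ η, rinner B ξ η = rinner B ζ η) : ξ = ζ := by
  have h1 : ∀ η, rinner B (ξ + (-1 : ℂ) • ζ) η = 0 := fun η => by
    rw [rinner_add_left, rinner_smul_left, h]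
    simp
  have h2 := norm_rinner_self (B := B) (ξ + (-1 : ℂ) • ζ)
  rw [h1, norm_zero, eq_comm, sq_eq_zero_iff, norm_eq_zero, neg_one_smul, ← sub_eq_add_neg,
    sub_eq_zero] at h2
  exact h2

lemma op_smul_op_smul (b c : B) (ξ : E) :
    MulOpposite.op c • MulOpposite.op b • ξ = MulOpposite.op (b * c) • ξ :=
  rinner_ext (B := B) fun η => by simp only [rinner_op_left, star_mul, mul_assoc]

/-- The Gram matrix of finitely many vectors of a Hilbert module. -/
def gram (B : Type u) [NonUnitalCStarAlgebra B] [PartialOrder B]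
    {E : Type v} [NormedAddCommGroup E] [NormedSpace ℂ E] [SMul Bᵐᵒᵖ E] [CStarModule Bᵐᵒᵖ E]
    {n : ℕ} (ξ : Fin n → E) : CStarMatrix (Fin n) (Fin n) B :=
  CStarMatrix.ofMatrix (Matrix.of fun i j => rinner B (ξ i) (ξ j))

lemma gram_apply {n : ℕ} (ξ : Fin n → E) (i j : Fin n) : gram B ξ i j = rinner B (ξ i) (ξ j) := rfl

lemma gram_isSelfAdjoint {n : ℕ} (ξ : Fin n → E) : IsSelfAdjoint (gram B ξ) := by
  ext i j
  rw [CStarMatrix.star_apply, gram_apply, gram_apply, star_rinner]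

/-- The right action of matrices over `B` on row vectors of elements of `E`. -/
def rowMul {n : ℕ} (ξ : Fin n → E) (a : CStarMatrix (Fin n) (Fin n) B) : Fin n → E :=
  fun j => ∑ i, MulOpposite.op (a i j) • ξ i

lemma gram_rowMul {n : ℕ} (ξ : Fin n → E) (a : CStarMatrix (Fin n) (Fin n) B) :
    gram B (rowMul ξ a) = star a * gram B ξ * a := by
  ext i j
  simp only [gram_apply, rowMul, rinner_sum_left, rinner_sum_right, rinner_op_left,
    rinner_op_right, CStarMatrix.mul_apply, CStarMatrix.star_apply, Finset.sum_mul]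

variable [StarOrderedRing B]

lemma eq_zero_of_diag_nonpos {n : ℕ} (c : CStarMatrix (Fin n) (Fin n) B)
    (h : ∀ k, (star c * c) k k ≤ 0) : c = 0 := by
  ext i k
  have h1 : (star c * c) k k = ∑ j, star (c j k) * c j k := by
    simp [CStarMatrix.mul_apply, CStarMatrix.star_apply]
  have h2 : star (c i k) * c i k ≤ 0 :=
    (Finset.single_le_sum (f := fun j => star (c j k) * c j k)
      (fun j _ => star_mul_self_nonneg _) (Finset.mem_univ i)).trans (h1 ▸ h k)
  have h3 := le_antisymm h2 (star_mul_self_nonneg _)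
  simpa using (CStarRing.star_mul_self_eq_zero_iff _).1 h3

/-- Gram matrices are positive. -/
lemma gram_nonneg {n : ℕ} (ξ : Fin n → E) : 0 ≤ gram B ξ := by
  obtain ⟨m, c, hmc, hc⟩ := exists_conj_eq_neg _ (gram_isSelfAdjoint (B := B) ξ)
  refine hc (eq_zero_of_diag_nonpos c fun k => ?_)
  rw [← gram_rowMul, eq_comm, neg_eq_iff_eq_neg] at hmc
  rw [hmc, CStarMatrix.neg_apply, gram_apply]
  exact neg_nonpos.2 (rinner_self_nonneg _)

end Module

/-! ### Representations and intertwining operators -/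

/-- A representation of the C⋆-algebra `B` on a Hilbert space. -/
structure StarRep (B : Type u) [NonUnitalCStarAlgebra B] where
  /-- the Hilbert space -/
  carrier : Type v
  [normedAddCommGroup : NormedAddCommGroup carrier]
  [innerProductSpace : InnerProductSpace ℂ carrier]
  [completeSpace : CompleteSpace carrier]
  /-- the ⋆-homomorphism -/
  σ : B →⋆ₙₐ[ℂ] (carrier →L[ℂ] carrier)

attribute [instance] StarRep.normedAddCommGroup StarRep.innerProductSpace StarRep.completeSpace

instance {B : Type u} [NonUnitalCStarAlgebra B] : CoeSort (StarRep.{u, v} B) (Type v) :=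
  ⟨StarRep.carrier⟩

/-- Bounded operators that intertwine two representations. -/
structure Intertwiner {B : Type u} [NonUnitalCStarAlgebra B] (R S : StarRep.{u, v} B) where
  /-- the bounded operator -/
  op : R →L[ℂ] S
  comm : ∀ b x, op (R.σ b x) = S.σ b (op x)

namespace Intertwiner

variable {B : Type u} [NonUnitalCStarAlgebra B] {R S T : StarRep.{u, v} B}

/-- The identity operator. -/
def id (R : StarRep.{u, v} B) : Intertwiner R R := ⟨ContinuousLinearMap.id ℂ R, fun _ _ => rfl⟩

/-- The product of two operators. -/
def comp (g : Intertwiner S T) (f : Intertwiner R S) : Intertwiner R T :=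
  ⟨g.op.comp f.op, fun b x => by simp [f.comm, g.comm]⟩

lemma inner_σ (b : B) (x y : R) : ⟪R.σ b x, y⟫_ℂ = ⟪x, R.σ (star b) y⟫_ℂ := by
  rw [map_star, ContinuousLinearMap.star_eq_adjoint, ContinuousLinearMap.adjoint_inner_right]

/-- The adjoint operator. -/
noncomputable def adjoint (f : Intertwiner R S) : Intertwiner S R where
  op := ContinuousLinearMap.adjoint f.op
  comm b x := by
    refine ext_inner_right ℂ fun y => ?_
    rw [ContinuousLinearMap.adjoint_inner_left, inner_σ, inner_σ,
      ContinuousLinearMap.adjoint_inner_left, f.comm]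

end Intertwiner

/-! ### Correspondences and the interior tensor product with a representation -/

section Tensor

variable (B : Type u) [NonUnitalCStarAlgebra B] [PartialOrder B] [StarOrderedRing B]
variable (E : Type v) [NormedAddCommGroup E] [NormedSpace ℂ E] [SMul Bᵐᵒᵖ E] [CStarModule Bᵐᵒᵖ E]

/-- The structure of a C⋆-correspondence over `B` on the Hilbert `B`-module `E`: a nondegenerate
⋆-homomorphism `φ` from `B` to the adjointable operators on `E`. -/
class CStarCorrespondence where
  /-- the left action -/
  φ : B →ₙₐ[ℂ] (E →L[ℂ] E)
  rinner_φ : ∀ (b : B) (ξ η : E), rinner B (φ b ξ) η = rinner B ξ (φ (star b) η)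
  nondegenerate : (Submodule.span ℂ {ζ : E | ∃ b ξ, ζ = φ b ξ}).topologicalClosure = ⊤

variable {B}

/-- The algebraic tensor product of `E` with the space of a representation, to be given the
semi-inner product `⟪ξ ⊗ h, η ⊗ k⟫ = ⟪h, σ ⟪ξ, η⟫ k⟫`. -/
def PreTensor (R : StarRep.{u, v} B) : Type v := E ⊗[ℂ] R

namespace PreTensor

variable (R S : StarRep.{u, v} B)

noncomputable instance : AddCommGroup (PreTensor E R) := inferInstanceAs (AddCommGroup (E ⊗[ℂ] R))
noncomputable instance : Module ℂ (PreTensor E R) := inferInstanceAs (Module ℂ (E ⊗[ℂ] R))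

variable {E R}

/-- The elementary tensor `ξ ⊗ h`. -/
def tmul (ξ : E) (h : R) : PreTensor E R := ξ ⊗ₜ[ℂ] h

@[elab_as_elim]
lemma induction {P : PreTensor E R → Prop} (x : PreTensor E R) (zero : P 0)
    (tmul : ∀ ξ h, P (tmul ξ h)) (add : ∀ x y, P x → P y → P (x + y)) : P x :=
  TensorProduct.induction_on x zero tmul add

variable (E R)

/-- The linear functional `⟪ξ ⊗ h, ·⟫`. -/
noncomputable def formAux (ξ : E) (h : R) : PreTensor E R →ₗ[ℂ] ℂ :=
  TensorProduct.lift (LinearMap.mk₂ ℂ (fun η k => ⟪h, R.σ (rinner B ξ η) k⟫_ℂ)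
    (by intros; simp [rinner_add_right])
    (by intros; simp [rinner_smul_right])
    (by intros; simp)
    (by intros; simp))

lemma formAux_tmul (ξ η : E) (h k : R) :
    formAux E R ξ h (tmul η k) = ⟪h, R.σ (rinner B ξ η) k⟫_ℂ := rfl

lemma hom_ext {M : Type*} [AddCommGroup M] [Module ℂ M] {f g : PreTensor E R →ₗ[ℂ] M}
    (h : ∀ ξ x, f (tmul ξ x) = g (tmul ξ x)) : f = g := TensorProduct.ext' h

/-- The semi-inner product of the algebraic tensor product. -/
noncomputable def form : PreTensor E R →ₗ⋆[ℂ] PreTensor E R →ₗ[ℂ] ℂ :=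
  TensorProduct.lift (LinearMap.mk₂'ₛₗ (starRingEnd ℂ) (starRingEnd ℂ) (formAux E R)
    (by intros; apply hom_ext; intros
        simp [formAux_tmul, rinner_add_left])
    (by intros; apply hom_ext; intros
        simp [formAux_tmul, rinner_smul_left])
    (by intros; apply hom_ext; intros
        simp [formAux_tmul])
    (by intros; apply hom_ext; intros
        simp [formAux_tmul, mul_comm]))

lemma form_tmul_tmul (ξ η : E) (h k : R) :
    form E R (tmul ξ h) (tmul η k) = ⟪h, R.σ (rinner B ξ η) k⟫_ℂ := rfl

lemma exists_sum (x : PreTensor E R) :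
    ∃ (n : ℕ) (ξ : Fin n → E) (h : Fin n → R), x = ∑ i, tmul (ξ i) (h i) :=
  TensorProduct.exists_sum_tmul_eq (R := ℂ) (M := E) (N := R) x

lemma sum_inner_σ_mul {n : ℕ} (d : CStarMatrix (Fin n) (Fin n) B) (h : Fin n → R) :
    ∑ i, ∑ j, ⟪h i, R.σ ((star d * d) i j) (h j)⟫_ℂ =
      ∑ k, ⟪∑ j, R.σ (d k j) (h j), ∑ j, R.σ (d k j) (h j)⟫_ℂ := by
  simp only [CStarMatrix.mul_apply, CStarMatrix.star_apply, map_sum, map_mul,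
    _root_.sum_apply, inner_sum, sum_inner, mul_apply_eq_comp, Intertwiner.inner_σ]
  calc _ = ∑ i, ∑ k, ∑ j, ⟪h i, R.σ (star (d k i)) (R.σ (d k j) (h j))⟫_ℂ :=
        Finset.sum_congr rfl fun _ _ => Finset.sum_comm
    _ = ∑ k, ∑ i, ∑ j, ⟪h i, R.σ (star (d k i)) (R.σ (d k j) (h j))⟫_ℂ := Finset.sum_comm
    _ = _ := Finset.sum_congr rfl fun _ _ => Finset.sum_comm

lemma form_sum {n : ℕ} (ξ : Fin n → E) (h : Fin n → R) :
    form E R (∑ i, tmul (ξ i) (h i)) (∑ i, tmul (ξ i) (h i)) =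
      ∑ i, ∑ j, ⟪h i, R.σ (gram B ξ i j) (h j)⟫_ℂ := by
  simp only [map_sum, LinearMap.sum_apply, form_tmul_tmul, gram_apply]
  exact Finset.sum_comm

lemma form_self_nonneg (x : PreTensor E R) : 0 ≤ form E R x x := by
  obtain ⟨n, ξ, h, rfl⟩ := exists_sum E R x
  obtain ⟨d, hd⟩ := exists_eq_star_mul_self (gram_nonneg (B := B) ξ)
  rw [form_sum, hd, sum_inner_σ_mul]
  exact Finset.sum_nonneg fun k _ => RCLike.nonneg_iff.mpr ⟨inner_self_nonneg, inner_self_im _⟩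

lemma form_conj_symm (x y : PreTensor E R) : starRingEnd ℂ (form E R y x) = form E R x y := by
  induction x using induction with
  | zero => simp
  | add x x' hx hx' => simp [hx, hx']
  | tmul ξ h =>
    induction y using induction with
    | zero => simp
    | add y y' hy hy' => simp [hy, hy']
    | tmul η k =>
      rw [form_tmul_tmul, form_tmul_tmul, inner_conj_symm, Intertwiner.inner_σ, star_rinner]

/-- The semi-inner product space structure of the algebraic tensor product. -/
noncomputable abbrev core : PreInnerProductSpace.Core ℂ (PreTensor E R) where
  inner x y := form E R x y
  conj_inner_symm := form_conj_symm E R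
  re_inner_nonneg x := (RCLike.nonneg_iff.mp (form_self_nonneg E R x)).1
  add_left x y z := by simp
  smul_left x y z := by simp

noncomputable instance : SeminormedAddCommGroup (PreTensor E R) :=
  InnerProductSpace.Core.toSeminormedAddCommGroup (c := core E R)

noncomputable instance : InnerProductSpace ℂ (PreTensor E R) :=
  InnerProductSpace.ofCore (core E R)

lemma inner_tmul_tmul (ξ η : E) (h k : R) :
    ⟪(tmul ξ h : PreTensor E R), tmul η k⟫_ℂ = ⟪h, R.σ (rinner B ξ η) k⟫_ℂ := rfl


lemma norm_tmul_le (ξ : E) (h : R) : ‖(tmul ξ h : PreTensor E R)‖ ≤ ‖ξ‖ * ‖h‖ := by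
  have h1 : ‖(tmul ξ h : PreTensor E R)‖ ^ 2 ≤ (‖ξ‖ * ‖h‖) ^ 2 := by
    rw [← inner_self_eq_norm_sq (𝕜 := ℂ), inner_tmul_tmul]
    calc RCLike.re ⟪h, R.σ (rinner B ξ ξ) h⟫_ℂ ≤ ‖⟪h, R.σ (rinner B ξ ξ) h⟫_ℂ‖ := RCLike.re_le_norm _
      _ ≤ ‖h‖ * ‖R.σ (rinner B ξ ξ) h‖ := norm_inner_le_norm _ _
      _ ≤ ‖h‖ * (‖rinner B ξ ξ‖ * ‖h‖) := by
        gcongr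
        exact (R.σ (rinner B ξ ξ)).le_of_opNorm_le
          (NonUnitalStarAlgHom.norm_apply_le R.σ (rinner B ξ ξ)) h
      _ = (‖ξ‖ * ‖h‖) ^ 2 := by rw [norm_rinner_self]; ring
  exact le_of_sq_le_sq h1 (by positivity)

/-- The operator `A ⊗ T` on algebraic tensor products. -/
noncomputable def map {R S : StarRep.{u, v} B} (A : E →L[ℂ] E) (T : R →L[ℂ] S) :
    PreTensor E R →ₗ[ℂ] PreTensor E S :=
  TensorProduct.map (A : E →ₗ[ℂ] E) (T : R →ₗ[ℂ] S)

lemma map_tmul {R S : StarRep.{u, v} B} (A : E →L[ℂ] E) (T : R →L[ℂ] S) (ξ : E) (h : R) :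
    map E A T (tmul ξ h) = tmul (A ξ) (T h) := rfl

lemma exists_norm_iterate_le (A : E →L[ℂ] E) (T : R →L[ℂ] R) (x : PreTensor E R) :
    ∃ M : ℝ, ∀ n : ℕ, ‖(map E A T)^[n] x‖ ≤ M * (‖A‖ * ‖T‖) ^ n := by
  induction x using induction with
  | zero => exact ⟨0, fun n => by simp [iterate_map_zero]⟩
  | add x y hx hy =>
    obtain ⟨M, hM⟩ := hx
    obtain ⟨N, hN⟩ := hy
    refine ⟨M + N, fun n => ?_⟩
    rw [iterate_map_add, add_mul]
    exact (norm_add_le _ _).trans (add_le_add (hM n) (hN n))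
  | tmul ξ h =>
    refine ⟨‖ξ‖ * ‖h‖, fun n => ?_⟩
    have h2 : ∀ {X : Type v} [NormedAddCommGroup X] [NormedSpace ℂ X] (L : X →L[ℂ] X) (z : X),
        ‖L^[n] z‖ ≤ ‖L‖ ^ n * ‖z‖ := by
      intro X _ _ L z
      induction n with
      | zero => simp
      | succ n ih =>
        rw [Function.iterate_succ_apply', pow_succ', mul_assoc]
        exact (L.le_opNorm _).trans (mul_le_mul_of_nonneg_left ih (norm_nonneg L))
    have h1 : (map E A T)^[n] (tmul ξ h) = tmul (A^[n] ξ) (T^[n] h) := by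
      clear h2
      induction n with
      | zero => rfl
      | succ n ih => rw [Function.iterate_succ_apply', ih, map_tmul, Function.iterate_succ_apply',
          Function.iterate_succ_apply']
    rw [h1]
    refine (norm_tmul_le E R _ _).trans ?_
    calc ‖A^[n] ξ‖ * ‖T^[n] h‖ ≤ (‖A‖ ^ n * ‖ξ‖) * (‖T‖ ^ n * ‖h‖) := by
          gcongr <;> apply h2
      _ = _ := by ring

end PreTensor

/-- A symmetric operator on a semi-inner product space is bounded if its powers have at most
exponential growth on every vector. -/
lemma norm_le_of_iterate {D : Type*} [SeminormedAddCommGroup D] [InnerProductSpace ℂ D]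
    (f : D →ₗ[ℂ] D) (hf : ∀ x y, ⟪f x, y⟫_ℂ = ⟪x, f y⟫_ℂ) {r M : ℝ} (hr : 0 ≤ r) (x : D)
    (hM : ∀ n : ℕ, ‖f^[n] x‖ ≤ M * r ^ n) : ‖f x‖ ≤ r * ‖x‖ := by
  set a : ℕ → ℝ := fun n => ‖f^[n] x‖ with ha
  have a0 : ∀ n, 0 ≤ a n := fun n => norm_nonneg _
  have conv : ∀ n, a (n + 1) ^ 2 ≤ a n * a (n + 2) := by
    intro n
    have h1 : ⟪f^[n + 1] x, f^[n + 1] x⟫_ℂ = ⟪f^[n] x, f^[n + 2] x⟫_ℂ := by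
      conv_lhs => rw [Function.iterate_succ_apply', hf]
      rw [← Function.iterate_succ_apply' f n, ← Function.iterate_succ_apply' f (n + 1)]
    calc a (n + 1) ^ 2 = ‖⟪f^[n + 1] x, f^[n + 1] x⟫_ℂ‖ := by
          rw [inner_self_eq_norm_sq_to_K]; simp [ha]
      _ ≤ a n * a (n + 2) := by rw [h1]; exact norm_inner_le_norm _ _
  have ratio : ∀ n, a 1 * a n ≤ a 0 * a (n + 1) := by
    intro n
    induction n with
    | zero => rw [mul_comm]
    | succ n ih =>
      rcases (a0 (n + 1)).eq_or_lt with h | h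
      · rw [← h, mul_zero]; exact mul_nonneg (a0 _) (a0 _)
      · refine le_of_mul_le_mul_right ?_ h
        calc a 1 * a (n + 1) * a (n + 1) = a 1 * a (n + 1) ^ 2 := by ring
          _ ≤ a 1 * (a n * a (n + 2)) := by gcongr; exact conv n
          _ = (a 1 * a n) * a (n + 2) := by ring
          _ ≤ (a 0 * a (n + 1)) * a (n + 2) := by gcongr
          _ = a 0 * a (n + 1 + 1) * a (n + 1) := by ring
  have pw : ∀ n, a 1 ^ n * a 0 ≤ a 0 ^ n * a n := by
    intro n
    induction n with
    | zero => simp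
    | succ n ih =>
      calc a 1 ^ (n + 1) * a 0 = a 1 * (a 1 ^ n * a 0) := by ring
        _ ≤ a 1 * (a 0 ^ n * a n) := by gcongr
        _ = a 0 ^ n * (a 1 * a n) := by ring
        _ ≤ a 0 ^ n * (a 0 * a (n + 1)) := by exact mul_le_mul_of_nonneg_left (ratio n) (pow_nonneg (a0 0) n)
        _ = _ := by ring
  change a 1 ≤ r * a 0
  by_contra! hlt
  have h1 : 0 < a 1 := (mul_nonneg hr (a0 0)).trans_lt hlt
  have h2 : ∀ n, a 0 ≤ M * (r * a 0 / a 1) ^ n := by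
    intro n
    rw [div_pow, mul_div_assoc', le_div_iff₀ (by positivity)]
    calc a 0 * a 1 ^ n = a 1 ^ n * a 0 := mul_comm _ _
      _ ≤ a 0 ^ n * a n := pw n
      _ ≤ a 0 ^ n * (M * r ^ n) := by gcongr; exact hM n
      _ = M * (r * a 0) ^ n := by ring
  have h3 : Filter.Tendsto (fun n : ℕ => M * (r * a 0 / a 1) ^ n) Filter.atTop (nhds (M * 0)) :=
    (tendsto_pow_atTop_nhds_zero_of_lt_one (div_nonneg (mul_nonneg hr (a0 0)) h1.le)
      ((div_lt_one h1).2 hlt)).const_mul M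
  have h4 : a 0 = 0 := le_antisymm (by simpa using ge_of_tendsto' h3 h2) (a0 0)
  have h5 := conv 0
  rw [zero_add, h4, zero_mul] at h5
  exact absurd h5 (not_le.2 (by positivity))

namespace PreTensor

variable {E} {R S : StarRep.{u, v} B}

lemma norm_map_le (A A' : E →L[ℂ] E) (T : R →L[ℂ] S) (T' : S →L[ℂ] R)
    (h : ∀ x y, ⟪map E A T x, y⟫_ℂ = ⟪x, map E A' T' y⟫_ℂ) (x : PreTensor E R) :
    ‖map E A T x‖ ≤ √(‖A'.comp A‖ * ‖T'.comp T‖) * ‖x‖ := by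
  have hcomp : ∀ y, map E A' T' (map E A T y) = map E (A'.comp A) (T'.comp T) y := by
    intro y
    have : (map E A' T').comp (map E A T) = map E (A'.comp A) (T'.comp T) :=
      hom_ext E R fun _ _ => rfl
    exact LinearMap.congr_fun this y
  have h' : ∀ x y, ⟪map E A' T' x, y⟫_ℂ = ⟪x, map E A T y⟫_ℂ := fun x y => by
    rw [← inner_conj_symm, ← h, inner_conj_symm]
  obtain ⟨M, hM⟩ := exists_norm_iterate_le E R (A'.comp A) (T'.comp T) x
  have h1 := norm_le_of_iterate (map E (A'.comp A) (T'.comp T))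
    (fun y z => by rw [← hcomp, h', h, hcomp]) (by positivity) x hM
  have h2 : ‖map E A T x‖ ^ 2 ≤ ‖A'.comp A‖ * ‖T'.comp T‖ * ‖x‖ ^ 2 := by
    have h3 : ‖map E A T x‖ ^ 2 = ‖⟪x, map E (A'.comp A) (T'.comp T) x⟫_ℂ‖ := by
      rw [← hcomp, ← h, inner_self_eq_norm_sq_to_K]; simp
    rw [h3]
    refine (norm_inner_le_norm _ _).trans ?_
    nlinarith [norm_nonneg x]
  refine le_of_sq_le_sq ?_ (by positivity)
  rwa [mul_pow, Real.sq_sqrt (by positivity)]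

lemma inner_map_left [CStarCorrespondence B E] (b : B) (x y : PreTensor E R) :
    ⟪map E (CStarCorrespondence.φ b) (ContinuousLinearMap.id ℂ R) x, y⟫_ℂ =
      ⟪x, map E (CStarCorrespondence.φ (star b)) (ContinuousLinearMap.id ℂ R) y⟫_ℂ := by
  induction x using induction with
  | zero => simp
  | add x x' hx hx' => simp [inner_add_left, hx, hx']
  | tmul ξ h =>
    induction y using induction with
    | zero => simp
    | add y y' hy hy' => simp [inner_add_right, hy, hy']
    | tmul η k =>
      simp [map_tmul, inner_tmul_tmul, CStarCorrespondence.rinner_φ]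

lemma inner_map_right (T : Intertwiner R S) (x : PreTensor E R) (y : PreTensor E S) :
    ⟪map E (ContinuousLinearMap.id ℂ E) T.op x, y⟫_ℂ =
      ⟪x, map E (ContinuousLinearMap.id ℂ E) T.adjoint.op y⟫_ℂ := by
  induction x using induction with
  | zero => simp
  | add x x' hx hx' => simp [inner_add_left, hx, hx']
  | tmul ξ h =>
    induction y using induction with
    | zero => simp
    | add y y' hy hy' => simp [inner_add_right, hy, hy']
    | tmul η k =>
      simp only [map_tmul, inner_tmul_tmul, ContinuousLinearMap.id_apply, ← T.adjoint.comm]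
      exact (ContinuousLinearMap.adjoint_inner_right _ _ _).symm

/-- The bounded operator `φ b ⊗ I` on the algebraic tensor product. -/
noncomputable def left [CStarCorrespondence B E] (b : B) : PreTensor E R →L[ℂ] PreTensor E R :=
  (map E (CStarCorrespondence.φ b) (ContinuousLinearMap.id ℂ R)).mkContinuous _
    (norm_map_le _ _ _ _ (inner_map_left b))

/-- The bounded operator `I ⊗ T` on the algebraic tensor product. -/
noncomputable def right (T : Intertwiner R S) : PreTensor E R →L[ℂ] PreTensor E S :=
  (map E (ContinuousLinearMap.id ℂ E) T.op).mkContinuous _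
    (norm_map_le _ _ _ _ (inner_map_right T))

lemma left_tmul [CStarCorrespondence B E] (b : B) (ξ : E) (h : R) :
    left b (tmul ξ h) = tmul (CStarCorrespondence.φ b ξ) h := rfl

lemma right_tmul (T : Intertwiner R S) (ξ : E) (h : R) :
    right T (tmul ξ h) = tmul ξ (T.op h) := rfl

end PreTensor

section Left

open UniformSpace

variable [CStarCorrespondence B E]

lemma PreTensor.left_congr {R : StarRep.{u, v} B} {f g : PreTensor E R →L[ℂ] PreTensor E R}
    (h : ∀ ξ x, f (tmul ξ x) = g (tmul ξ x)) : f = g := by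
  ext1 x
  exact LinearMap.congr_fun (hom_ext E R (f := f.toLinearMap) (g := g.toLinearMap) h) x

lemma completion_ext {D : Type*} [SeminormedAddCommGroup D] [NormedSpace ℂ D] {K : Type*}
    [NormedAddCommGroup K] [NormedSpace ℂ K] {f g : Completion D →L[ℂ] K}
    (h : ∀ x : D, f x = g x) : f = g := by
  ext1 x
  induction x using Completion.induction_on with
  | hp => exact isClosed_eq f.continuous g.continuous
  | ih a => exact h a

namespace PreTensor

variable {E} {R : StarRep.{u, v} B}

lemma left_add (a b : B) : (left (a + b) : PreTensor E R →L[ℂ] _) = left a + left b :=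
  left_congr E fun ξ h => by
    rw [_root_.add_apply, left_tmul, left_tmul, left_tmul, map_add, _root_.add_apply]
    exact TensorProduct.add_tmul _ _ _

lemma left_zero : (left (0 : B) : PreTensor E R →L[ℂ] _) = 0 :=
  left_congr E fun ξ h => by
    rw [left_tmul, map_zero]
    exact TensorProduct.zero_tmul _ _

lemma left_smul (z : ℂ) (b : B) : (left (z • b) : PreTensor E R →L[ℂ] _) = z • left b :=
  left_congr E fun ξ h => by
    rw [_root_.smul_apply, left_tmul, left_tmul, map_smul, _root_.smul_apply]
    rfl

lemma left_mul (a b : B) : (left (a * b) : PreTensor E R →L[ℂ] _) = (left a).comp (left b) :=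
  left_congr E fun ξ h => by
    rw [ContinuousLinearMap.comp_apply, left_tmul, left_tmul, left_tmul, map_mul]
    rfl

end PreTensor

/-- The interior tensor product `E ⊗_σ H`, which is the Hilbert space completion of the algebraic
tensor product, with the representation `b ↦ φ b ⊗ I`. -/
noncomputable def interior (R : StarRep.{u, v} B) : StarRep.{u, v} B where
  carrier := Completion (PreTensor E R)
  σ :=
    { toFun := fun b => (PreTensor.left b).completion
      map_smul' := fun z b => completion_ext fun x => by simp [PreTensor.left_smul]
      map_zero' := completion_ext fun x => by
        simp [PreTensor.left_zero, Completion.coe_zero]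
      map_add' := fun a b => completion_ext fun x => by
        simp [PreTensor.left_add, Completion.coe_add]
      map_mul' := fun a b => completion_ext fun x => by simp [PreTensor.left_mul]
      map_star' := fun b => by
        refine (ContinuousLinearMap.eq_adjoint_iff _ _).mpr fun x y => ?_
        induction x, y using Completion.induction_on₂ with
        | hp => apply isClosed_eq <;> fun_prop
        | ih x y =>
          have h := PreTensor.inner_map_left (E := E) (R := R) (star b) x y
          rw [star_star] at h
          rw [ContinuousLinearMap.completion_apply_coe, ContinuousLinearMap.completion_apply_coe,
            Completion.inner_coe, Completion.inner_coe]
          exact h }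

/-- The canonical map of the algebraic tensor product into `E ⊗_σ H`. -/
noncomputable def incl (R : StarRep.{u, v} B) : PreTensor E R →L[ℂ] interior E R :=
  Completion.toComplL

lemma denseRange_incl (R : StarRep.{u, v} B) : DenseRange (incl E R) :=
  Completion.denseRange_coe (α := PreTensor E R)

lemma isUniformInducing_incl (R : StarRep.{u, v} B) : IsUniformInducing (incl E R) :=
  Completion.isUniformInducing_coe (PreTensor E R)

variable {E}
variable {R S : StarRep.{u, v} B}

/-- The elementary tensor `ξ ⊗ h` in `E ⊗_σ H`. -/
noncomputable def tprod (ξ : E) (h : R) : interior E R := incl E R (PreTensor.tmul ξ h)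

lemma inner_tprod (ξ η : E) (h k : R) :
    ⟪tprod ξ h, tprod η k⟫_ℂ = ⟪h, R.σ (rinner B ξ η) k⟫_ℂ :=
  Completion.inner_coe (𝕜 := ℂ) (PreTensor.tmul ξ h) (PreTensor.tmul η k)

lemma interior_σ_tprod (b : B) (ξ : E) (h : R) :
    (interior E R).σ b (tprod ξ h) = tprod (CStarCorrespondence.φ b ξ) h :=
  ContinuousLinearMap.completion_apply_coe (PreTensor.left b) (PreTensor.tmul ξ h)

lemma interior_ext {K : Type*} [NormedAddCommGroup K] [NormedSpace ℂ K]
    {f g : interior E R →L[ℂ] K} (h : ∀ (ξ : E) (x : R), f (tprod ξ x) = g (tprod ξ x)) :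
    f = g := by
  have h1 : f.comp (incl E R) = g.comp (incl E R) := by
    ext1 x
    exact LinearMap.congr_fun (PreTensor.hom_ext E R (f := (f.comp (incl E R)).toLinearMap)
      (g := (g.comp (incl E R)).toLinearMap) h) x
  ext1 x
  exact congr_fun ((denseRange_incl E R).equalizer f.continuous g.continuous
    (funext fun x => congr($h1 x))) x

/-- The operator `I_E ⊗ T : E ⊗ H → E ⊗ K`. -/
noncomputable def interiorMap (T : Intertwiner R S) : Intertwiner (interior E R) (interior E S) :=
  have key : ∀ (ξ : E) (h : R), ((incl E S).comp (PreTensor.right T)).extend (incl E R) (tprod ξ h)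
      = tprod ξ (T.op h) := fun ξ h => ContinuousLinearMap.extend_eq _ (denseRange_incl E R)
        (isUniformInducing_incl E R) (PreTensor.tmul ξ h)
  { op := ((incl E S).comp (PreTensor.right T)).extend (incl E R)
    comm := fun b x => by
      suffices h : (((incl E S).comp (PreTensor.right T)).extend (incl E R)).comp
          ((interior E R).σ b) = ((interior E S).σ b).comp
            (((incl E S).comp (PreTensor.right T)).extend (incl E R)) from congr($h x)
      refine interior_ext fun ξ h => ?_
      rw [ContinuousLinearMap.comp_apply, ContinuousLinearMap.comp_apply, interior_σ_tprod, key,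
        key, interior_σ_tprod] }

lemma interiorMap_tprod (T : Intertwiner R S) (ξ : E) (h : R) :
    (interiorMap T).op (tprod ξ h) = tprod ξ (T.op h) :=
  ContinuousLinearMap.extend_eq _ (denseRange_incl E R) (isUniformInducing_incl E R)
    (PreTensor.tmul ξ h)

end Left

end Tensor

/-! ### Completely bounded covariant representations -/

lemma exists_approx {A : Type*} [NonUnitalCStarAlgebra A] [PartialOrder A] [StarOrderedRing A]
    {G : A} (hG : 0 ≤ G) {ε : ℝ} (hε : 0 < ε) :
    ∃ c s : A, G = star s * s ∧ ‖star c * G * c‖ ≤ 1 ∧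
      ‖G - G * (c * s) - star (c * s) * G + star (c * s) * G * (c * s)‖ ≤ ε := by
  set s := CFC.sqrt G with hs
  have hs0 : 0 ≤ s := CFC.sqrt_nonneg G
  have hsa : IsSelfAdjoint s := IsSelfAdjoint.of_nonneg hs0
  have hss : s * s = G := CFC.sqrt_mul_sqrt_self G hG
  have hpos : ∀ t : ℝ, 0 < t ^ 2 + ε := fun t => by positivity
  have cont : Continuous (fun t : ℝ => t / (t ^ 2 + ε)) :=
    continuous_id.div (by fun_prop) fun t => (hpos t).ne'
  have cont2 : Continuous (fun t : ℝ => t / (t ^ 2 + ε) * t) := cont.mul continuous_id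
  obtain ⟨c, hc⟩ : ∃ c, c = cfcₙ (fun t : ℝ => t / (t ^ 2 + ε)) s := ⟨_, rfl⟩
  have hcsa : star c = c := hc ▸ (cfcₙ_predicate (fun t : ℝ => t / (t ^ 2 + ε)) s).star_eq
  have hid : cfcₙ (fun t : ℝ => t) s = s := cfcₙ_id' ℝ s
  have hcs : cfcₙ (fun t : ℝ => t / (t ^ 2 + ε) * t) s = c * s := by
    rw [cfcₙ_mul (fun t : ℝ => t / (t ^ 2 + ε)) (fun t => t) s cont.continuousOn (by simp)
      continuous_id.continuousOn rfl, ← hc, hid]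
  have hcomm : s * c = c * s := by
    rw [hc]
    nth_rw 1 [← hid]
    nth_rw 4 [← hid]
    exact cfcₙ_commute_cfcₙ _ _ s
  have hp : star (c * s) = c * s := by rw [star_mul, hcsa, hsa.star_eq, hcomm]
  have hr : cfcₙ (fun t : ℝ => t - t * (t / (t ^ 2 + ε) * t)) s = s - s * (c * s) := by
    rw [cfcₙ_sub (fun t : ℝ => t) (fun t : ℝ => t * (t / (t ^ 2 + ε) * t)) s
      continuous_id.continuousOn rfl (continuous_id.mul cont2).continuousOn (by simp),
      cfcₙ_mul (fun t : ℝ => t) (fun t : ℝ => t / (t ^ 2 + ε) * t) s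
      continuous_id.continuousOn rfl cont2.continuousOn (by simp), hcs, hid]
  refine ⟨c, s, by rw [hsa.star_eq, hss], ?_, ?_⟩
  · have h1 : star c * G * c = star (c * s) * (c * s) := by
      rw [hp, hcsa, ← hss, ← mul_assoc, mul_assoc (c * s) s c, hcomm]
    rw [h1, CStarRing.norm_star_mul_self, ← hcs]
    refine mul_le_one₀ ?_ (norm_nonneg _) ?_ <;>
    · refine norm_cfcₙ_le fun t _ => ?_
      rw [Real.norm_of_nonneg (by rw [div_mul_eq_mul_div]; exact div_nonneg (mul_self_nonneg t) (hpos t).le),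
        div_mul_eq_mul_div, div_le_one (hpos t)]
      nlinarith
  · have h1 : G - G * (c * s) - star (c * s) * G + star (c * s) * G * (c * s)
        = star (s - s * (c * s)) * (s - s * (c * s)) := by
      rw [star_sub, star_mul s, hp, hsa.star_eq, ← hss]
      noncomm_ring
    have h2 : ‖s - s * (c * s)‖ ≤ √ε := by
      rw [← hr]
      refine norm_cfcₙ_le fun t _ => ?_
      have h3 : t - t * (t / (t ^ 2 + ε) * t) = t * ε / (t ^ 2 + ε) := by
        have := (hpos t).ne'
        field_simp
        ring
      rw [h3, norm_div, norm_mul, Real.norm_of_nonneg hε.le, Real.norm_of_nonneg (hpos t).le,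
        div_le_iff₀ (hpos t), Real.norm_eq_abs]
      have h4 := Real.sq_sqrt hε.le
      have h5 : √ε * (|t| * √ε) ≤ √ε * (t ^ 2 + ε) := by
        refine mul_le_mul_of_nonneg_left ?_ (Real.sqrt_nonneg _)
        nlinarith [sq_nonneg (|t| - √ε), sq_abs t, abs_nonneg t, Real.sqrt_nonneg ε]
      calc |t| * ε = √ε * (|t| * √ε) := by rw [← h4]; simp; ring
        _ ≤ _ := h5
    rw [h1, CStarRing.norm_star_mul_self]
    calc _ ≤ √ε * √ε := mul_le_mul h2 h2 (norm_nonneg _) (Real.sqrt_nonneg _)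
      _ = ε := Real.mul_self_sqrt hε.le

section Covariant

variable (B : Type u) [NonUnitalCStarAlgebra B] [PartialOrder B] [StarOrderedRing B]
variable (E : Type v) [NormedAddCommGroup E] [NormedSpace ℂ E] [SMul Bᵐᵒᵖ E] [CStarModule Bᵐᵒᵖ E]
variable {E} in
/-- Complete boundedness of a linear map `V : E → B(H)`. The norm of a matrix `(ξ i j)` over `E` is
the square root of the norm of the matrix `(∑ k, ⟪ξ k i, ξ k j⟫)` over `B`. Matrices over a
C⋆-algebra carry their C⋆-norm. -/
def IsCompletelyBounded {H : Type v} [NormedAddCommGroup H] [InnerProductSpace ℂ H]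
    [CompleteSpace H] (V : E →ₗ[ℂ] (H →L[ℂ] H)) : Prop :=
  ∃ C : ℝ, ∀ (n : ℕ) (ξ : Fin n → Fin n → E),
    ‖(CStarMatrix.ofMatrix (Matrix.of fun i j => V (ξ i j)) : CStarMatrix (Fin n) (Fin n) (H →L[ℂ] H))‖ ≤
      C * √‖(CStarMatrix.ofMatrix (Matrix.of fun i j => ∑ k, rinner B (ξ k i) (ξ k j)) :
        CStarMatrix (Fin n) (Fin n) B)‖

variable {B}

/-- A completely bounded covariant representation `(σ, V)` of the C⋆-correspondence `E` over `B`,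
where `R` consists of the Hilbert space and the (nondegenerate) representation `σ` on it. -/
structure CBCRep [CStarCorrespondence B E] (R : StarRep.{u, v} B) where
  nondegenerate : (Submodule.span ℂ {x : R | ∃ b h, x = R.σ b h}).topologicalClosure = ⊤
  /-- the linear map on the correspondence -/
  V : E →ₗ[ℂ] (R →L[ℂ] R)
  covariant : ∀ (b : B) (ξ : E) (c : B),
    V (CStarCorrespondence.φ b (MulOpposite.op c • ξ)) = R.σ b * V ξ * R.σ c
  completelyBounded : IsCompletelyBounded B V

namespace CBCRep

variable {E}

lemma φ_op [CStarCorrespondence B E] (b c : B) (ξ : E) :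
    CStarCorrespondence.φ b (MulOpposite.op c • ξ) =
      MulOpposite.op c • CStarCorrespondence.φ b ξ :=
  rinner_ext (B := B) fun η => by
    rw [CStarCorrespondence.rinner_φ, rinner_op_left, rinner_op_left, CStarCorrespondence.rinner_φ]

variable [CStarCorrespondence B E] {R : StarRep.{u, v} B} (π : CBCRep E R)

lemma eq_zero_of_σ (π : CBCRep E R) {x : R} (h : ∀ b, R.σ b x = 0) : x = 0 := by
  have hx : x ∈ (Submodule.span ℂ {x : R | ∃ b h, x = R.σ b h}).topologicalClosureᗮ := by
    rw [Submodule.orthogonal_closure, Submodule.mem_orthogonal]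
    intro y hy
    induction hy using Submodule.span_induction with
    | mem y hy =>
      obtain ⟨b, k, rfl⟩ := hy
      rw [Intertwiner.inner_σ, h, inner_zero_right]
    | zero => simp
    | add y z _ _ hy hz => rw [inner_add_left, hy, hz, add_zero]
    | smul c y _ hy => rw [inner_smul_left, hy, mul_zero]
  rwa [π.nondegenerate, Submodule.top_orthogonal_eq_bot, Submodule.mem_bot] at hx

lemma op_eq_of_σ (π : CBCRep E R) {S T : R →L[ℂ] R} (h : ∀ b c, R.σ b * S * R.σ c = R.σ b * T * R.σ c) : S = T := by
  have h1 : ∀ c k, S (R.σ c k) = T (R.σ c k) := fun c k => by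
    rw [← sub_eq_zero]
    refine π.eq_zero_of_σ fun b => ?_
    rw [map_sub, sub_eq_zero]
    exact congr($(h b c) k)
  have h2 : Set.EqOn S T (Submodule.span ℂ {x : R | ∃ b h, x = R.σ b h}) := by
    refine LinearMap.eqOn_span' (f := S.toLinearMap) (g := T.toLinearMap) ?_
    rintro _ ⟨c, k, rfl⟩
    exact h1 c k
  ext1 x
  have hx : x ∈ (Submodule.span ℂ {x : R | ∃ b h, x = R.σ b h}).topologicalClosure :=
    π.nondegenerate ▸ Submodule.mem_top
  exact h2.closure S.continuous T.continuous hx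

lemma V_left (b : B) (ξ : E) : π.V (CStarCorrespondence.φ b ξ) = R.σ b * π.V ξ := by
  refine π.op_eq_of_σ fun a c => ?_
  rw [← π.covariant, ← φ_op, ← mul_assoc, ← map_mul, ← π.covariant, map_mul]
  rfl

lemma V_right (ξ : E) (c : B) : π.V (MulOpposite.op c • ξ) = π.V ξ * R.σ c := by
  refine π.op_eq_of_σ fun a d => ?_
  rw [← π.covariant, op_smul_op_smul, π.covariant, map_mul]
  simp only [mul_assoc]

lemma row_bound : ∃ C : ℝ, 0 ≤ C ∧ ∀ {n : ℕ} (ζ : Fin n → E) (h : Fin n → R),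
    ‖∑ i, π.V (ζ i) (h i)‖ ^ 2 ≤ C ^ 2 * ‖gram B ζ‖ * ∑ i, ‖h i‖ ^ 2 := by
  obtain ⟨C, hC⟩ := π.completelyBounded
  refine ⟨max C 0, le_max_right _ _, fun {n} ζ h => ?_⟩
  rcases Nat.eq_zero_or_pos n with rfl | hn
  · simp
  set i0 : Fin n := ⟨0, hn⟩
  set ξ : Fin n → Fin n → E := fun k j => if k = i0 then ζ j else 0 with hξ
  have h1 := hC n ξ
  have h2 : (CStarMatrix.ofMatrix (Matrix.of fun i j => ∑ k, rinner B (ξ k i) (ξ k j)) :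
        CStarMatrix (Fin n) (Fin n) B) = gram B ζ := by
    ext i j
    rw [gram_apply, CStarMatrix.ofMatrix_apply, Matrix.of_apply, Finset.sum_eq_single i0]
    · simp [hξ]
    · intro k _ hk
      simp [hξ, hk, rinner]
    · simp
  rw [h2] at h1
  set M : CStarMatrix (Fin n) (Fin n) (R →L[ℂ] R) := CStarMatrix.ofMatrix (Matrix.of fun i j => π.V (ξ i j)) with hM
  have h3 : 0 ≤ algebraMap ℝ (CStarMatrix (Fin n) (Fin n) (R →L[ℂ] R)) (‖M‖ ^ 2) - star M * M :=
    sub_nonneg.2 CStarAlgebra.star_mul_le_algebraMap_norm_sq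
  obtain ⟨d, hd⟩ := exists_eq_star_mul_self h3
  have hsum : ∀ D : CStarMatrix (Fin n) (Fin n) (R →L[ℂ] R),
      ∑ i, ∑ j, ⟪h i, ((star D * D) i j) (h j)⟫_ℂ = ((∑ k, ‖∑ j, D k j (h j)‖ ^ 2 : ℝ) : ℂ) := by
    intro D
    have := PreTensor.sum_inner_σ_mul
      (⟨R, NonUnitalStarAlgHom.id ℂ (R →L[ℂ] R)⟩ : StarRep.{v, v} (R →L[ℂ] R)) D h
    refine Eq.trans this ?_
    rw [Complex.ofReal_sum]
    refine Finset.sum_congr rfl fun k _ => ?_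
    refine (inner_self_eq_norm_sq_to_K (𝕜 := ℂ) _).trans ?_
    simp
  have h4 := hsum M
  have h5 := hsum d
  rw [← hd] at h5
  have h6 : ∑ i, ∑ j, ⟪h i, ((algebraMap ℝ (CStarMatrix (Fin n) (Fin n) (R →L[ℂ] R)) (‖M‖ ^ 2)
      - star M * M) i j) (h j)⟫_ℂ = ((‖M‖ ^ 2 * ∑ i, ‖h i‖ ^ 2 : ℝ) : ℂ)
        - ((∑ k, ‖∑ j, M k j (h j)‖ ^ 2 : ℝ) : ℂ) := by
    rw [← h4, Complex.ofReal_mul, Complex.ofReal_sum, Finset.mul_sum, ← Finset.sum_sub_distrib]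
    refine Finset.sum_congr rfl fun i _ => ?_
    have h7 : ∀ j, (algebraMap ℝ (CStarMatrix (Fin n) (Fin n) (R →L[ℂ] R)) (‖M‖ ^ 2)) i j =
        if i = j then (((‖M‖ ^ 2 : ℝ) : ℂ) • (1 : R →L[ℂ] R)) else 0 := by
      intro j
      rw [Algebra.algebraMap_eq_smul_one, CStarMatrix.smul_apply, CStarMatrix.one_apply]
      split_ifs
      · rw [Complex.coe_smul]
      · rw [smul_zero]
    simp only [CStarMatrix.sub_apply, _root_.sub_apply, inner_sub_right, Finset.sum_sub_distrib, h7]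
    congr 1
    rw [Finset.sum_eq_single i]
    · rw [if_pos rfl, _root_.smul_apply, inner_smul_right]
      congr 1
      refine (inner_self_eq_norm_sq_to_K (𝕜 := ℂ) _).trans ?_
      simp
    · intro j _ hj
      rw [if_neg (Ne.symm hj)]
      simp
    · simp
  rw [h6, ← Complex.ofReal_sub] at h5
  have h8 : ‖M‖ ^ 2 * ∑ i, ‖h i‖ ^ 2 - ∑ k, ‖∑ j, M k j (h j)‖ ^ 2 =
      ∑ k, ‖∑ j, d k j (h j)‖ ^ 2 := by exact_mod_cast h5
  have h9 : ‖∑ i, π.V (ζ i) (h i)‖ ^ 2 ≤ ∑ k, ‖∑ j, M k j (h j)‖ ^ 2 := by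
    have h10 : ‖∑ i, π.V (ζ i) (h i)‖ ^ 2 = ‖∑ j, M i0 j (h j)‖ ^ 2 := by
      simp [hM, hξ]
    rw [h10]
    exact Finset.single_le_sum (f := fun k => ‖∑ j, M k j (h j)‖ ^ 2)
      (fun k _ => by positivity) (Finset.mem_univ i0)
  have h11 : 0 ≤ ∑ k, ‖∑ j, d k j (h j)‖ ^ 2 := Finset.sum_nonneg fun k _ => by positivity
  have h12 : ‖M‖ ^ 2 ≤ max C 0 ^ 2 * ‖gram B ζ‖ := by
    calc ‖M‖ ^ 2 ≤ (max C 0 * √‖gram B ζ‖) ^ 2 := by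
          gcongr
          exact h1.trans (by gcongr; exact le_max_left _ _)
      _ = _ := by rw [mul_pow, Real.sq_sqrt (norm_nonneg _)]
  calc _ ≤ ‖M‖ ^ 2 * ∑ i, ‖h i‖ ^ 2 := by linarith
    _ ≤ _ := by gcongr

/-- The linear map `ξ ⊗ h ↦ V ξ h` on the algebraic tensor product. -/
noncomputable def preTilde : PreTensor E R →ₗ[ℂ] R :=
  TensorProduct.lift (LinearMap.mk₂ ℂ (fun ξ h => π.V ξ h)
    (by intros; simp) (by intros; simp) (by intros; simp) (by intros; simp))

lemma preTilde_tmul (ξ : E) (h : R) :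
    π.preTilde (PreTensor.tmul (R := R) ξ h) = π.V ξ h := rfl

lemma gram_sub_rowMul {n : ℕ} (ξ : Fin n → E) (p : CStarMatrix (Fin n) (Fin n) B) :
    gram B (fun i => ξ i - rowMul ξ p i) =
      gram B ξ - gram B ξ * p - star p * gram B ξ + star p * gram B ξ * p := by
  have hs : ∀ x y z : E, rinner B (x - y) z = rinner B x z - rinner B y z := fun x y z => by
    rw [eq_sub_iff_add_eq, ← rinner_add_left, sub_add_cancel]
  have hs' : ∀ x y z : E, rinner B z (x - y) = rinner B z x - rinner B z y := fun x y z => by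
    rw [eq_sub_iff_add_eq, ← rinner_add_right, sub_add_cancel]
  ext i j
  rw [← gram_rowMul]
  simp only [gram_apply, CStarMatrix.sub_apply, CStarMatrix.add_apply, hs, hs']
  have h1 : (gram B ξ * p) i j = rinner B (ξ i) (rowMul ξ p j) := by
    simp [CStarMatrix.mul_apply, rowMul, rinner_sum_right, rinner_op_right, gram_apply]
  have h2 : (star p * gram B ξ) i j = rinner B (rowMul ξ p i) (ξ j) := by
    simp [CStarMatrix.mul_apply, rowMul, rinner_sum_left, rinner_op_left, gram_apply,
      CStarMatrix.star_apply]
  rw [h1, h2]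
  abel

lemma exists_preTilde_bound : ∃ C : ℝ, ∀ x, ‖π.preTilde x‖ ≤ C * ‖x‖ := by
  obtain ⟨C, hC0, hC⟩ := π.row_bound
  refine ⟨C, fun x => ?_⟩
  obtain ⟨n, ξ, h, rfl⟩ := PreTensor.exists_sum E R x
  set x : PreTensor E R := ∑ i, PreTensor.tmul (ξ i) (h i) with hx
  have key : ∀ ε : ℝ, 0 < ε → ‖π.preTilde x‖ ≤ C * ‖x‖ + C * √(∑ i, ‖h i‖ ^ 2) * √ε := by
    intro ε hε
    obtain ⟨c, s, hG, hc, hp⟩ := exists_approx (gram_nonneg (B := B) ξ) hε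
    have hsplit : π.preTilde x = ∑ i, π.V (ξ i - rowMul ξ (c * s) i) (h i)
        + ∑ k, π.V (rowMul ξ c k) (∑ j, R.σ (s k j) (h j)) := by
      have h1 : ∑ j, π.V (rowMul ξ (c * s) j) (h j) =
          ∑ k, π.V (rowMul ξ c k) (∑ j, R.σ (s k j) (h j)) := by
        simp only [rowMul, map_sum, V_right, _root_.sum_apply, mul_apply_eq_comp,
          CStarMatrix.mul_apply, map_mul]
        calc _ = ∑ j, ∑ k, ∑ i, π.V (ξ i) (R.σ (c i k) (R.σ (s k j) (h j))) :=
              Finset.sum_congr rfl fun _ _ => Finset.sum_comm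
          _ = ∑ k, ∑ j, ∑ i, π.V (ξ i) (R.σ (c i k) (R.σ (s k j) (h j))) := Finset.sum_comm
          _ = _ := rfl
      rw [← h1, ← Finset.sum_add_distrib, hx, map_sum]
      refine Finset.sum_congr rfl fun i _ => ?_
      rw [preTilde_tmul, map_sub, _root_.sub_apply, sub_add_cancel]
    have hnorm : ‖x‖ ^ 2 = ∑ k, ‖∑ j, R.σ (s k j) (h j)‖ ^ 2 := by
      have h1 : ((‖x‖ ^ 2 : ℝ) : ℂ) = ((∑ k, ‖∑ j, R.σ (s k j) (h j)‖ ^ 2 : ℝ) : ℂ) := by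
        have h2 : ⟪x, x⟫_ℂ = ∑ k, ⟪∑ j, R.σ (s k j) (h j), ∑ j, R.σ (s k j) (h j)⟫_ℂ := by
          rw [← PreTensor.sum_inner_σ_mul, ← hG]
          exact PreTensor.form_sum E R ξ h
        rw [Complex.ofReal_sum, Complex.ofReal_pow]
        refine (inner_self_eq_norm_sq_to_K (𝕜 := ℂ) x).symm.trans (h2.trans ?_)
        refine Finset.sum_congr rfl fun k _ => ?_
        rw [Complex.ofReal_pow]
        exact inner_self_eq_norm_sq_to_K (𝕜 := ℂ) _
      exact_mod_cast h1
    have h1 : ‖∑ i, π.V (ξ i - rowMul ξ (c * s) i) (h i)‖ ≤ C * √(∑ i, ‖h i‖ ^ 2) * √ε := by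
      refine le_of_sq_le_sq ?_ (by positivity)
      refine (hC _ h).trans ?_
      rw [gram_sub_rowMul, mul_pow, mul_pow, Real.sq_sqrt hε.le,
        Real.sq_sqrt (Finset.sum_nonneg fun i _ => by positivity), mul_right_comm (C ^ 2)]
      gcongr
    have h2 : ‖∑ k, π.V (rowMul ξ c k) (∑ j, R.σ (s k j) (h j))‖ ≤ C * ‖x‖ := by
      refine le_of_sq_le_sq ?_ (by positivity)
      refine (hC _ _).trans ?_
      rw [gram_rowMul, ← hnorm, mul_pow]
      gcongr
      exact mul_le_of_le_one_right (by positivity) hc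
    rw [hsplit]
    refine (norm_add_le _ _).trans ?_
    linarith
  have hlim : Filter.Tendsto (fun ε : ℝ => C * ‖x‖ + C * √(∑ i, ‖h i‖ ^ 2) * √ε)
      (nhdsWithin 0 (Set.Ioi 0)) (nhds (C * ‖x‖)) := by
    have : Continuous (fun ε : ℝ => C * ‖x‖ + C * √(∑ i, ‖h i‖ ^ 2) * √ε) := by fun_prop
    simpa using (this.tendsto 0).mono_left nhdsWithin_le_nhds
  exact ge_of_tendsto hlim (Filter.eventually_of_mem self_mem_nhdsWithin key)

lemma exists_preTilde_bound' : ∃ C : ℝ, ∀ x, ‖π.preTilde x‖ ≤ C * ‖(incl E R).toLinearMap x‖ := by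
  obtain ⟨C, hC⟩ := π.exists_preTilde_bound
  exact ⟨C, fun x => (hC x).trans_eq
    (congrArg (C * ·) (UniformSpace.Completion.norm_coe (E := PreTensor E R) x).symm)⟩

/-- The bounded operator `Ṽ : E ⊗_σ H → H`, `Ṽ (ξ ⊗ h) = V ξ h`, which intertwines `φ ⊗ I` and `σ`. -/
noncomputable def tilde : Intertwiner (interior E R) R :=
  have key : ∀ (ξ : E) (h : R), π.preTilde.extendOfNorm (incl E R).toLinearMap (tprod ξ h) = π.V ξ h :=
    fun ξ h => LinearMap.extendOfNorm_eq (f := π.preTilde) (denseRange_incl E R)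
      π.exists_preTilde_bound' (PreTensor.tmul ξ h)
  { op := π.preTilde.extendOfNorm (incl E R).toLinearMap
    comm := fun b x => by
      suffices h : (π.preTilde.extendOfNorm (incl E R).toLinearMap).comp ((interior E R).σ b) =
          (R.σ b).comp (π.preTilde.extendOfNorm (incl E R).toLinearMap) from congr($h x)
      refine interior_ext fun ξ h => ?_
      rw [ContinuousLinearMap.comp_apply, ContinuousLinearMap.comp_apply, interior_σ_tprod, key,
        key, V_left]
      rfl }

lemma tilde_tprod (ξ : E) (h : R) : π.tilde.op (tprod ξ h) = π.V ξ h :=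
  LinearMap.extendOfNorm_eq (f := π.preTilde) (denseRange_incl E R)
    π.exists_preTilde_bound' (PreTensor.tmul ξ h)

end CBCRep

end Covariant

/-! ### Moore-Penrose inverses -/

section MoorePenrose

variable {H K : Type v} [NormedAddCommGroup H] [InnerProductSpace ℂ H] [CompleteSpace H]
  [NormedAddCommGroup K] [InnerProductSpace ℂ K] [CompleteSpace K]

/-- `S` is the Moore-Penrose inverse of `T`. -/
structure IsMoorePenrose (T : H →L[ℂ] K) (S : K →L[ℂ] H) : Prop where
  mul_mul_self : T ∘L S ∘L T = T
  mul_mul_inv : S ∘L T ∘L S = S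
  adjoint_left : ContinuousLinearMap.adjoint (T ∘L S) = T ∘L S
  adjoint_right : ContinuousLinearMap.adjoint (S ∘L T) = S ∘L T

variable {B : Type u} [NonUnitalCStarAlgebra B] {R S : StarRep.{u, v} B}

/-- The Moore-Penrose inverse of an intertwining operator is an intertwining operator. -/
lemma IsMoorePenrose.comm {T : Intertwiner R S} {L : S →L[ℂ] R} (h : IsMoorePenrose T.op L) (b : B)
    (x : S) : L (S.σ b x) = R.σ b (L x) := by
  have hT : ∀ y, T.op (L (T.op y)) = T.op y := fun y => congr($(h.mul_mul_self) y)
  have hL : ∀ y, L (T.op (L y)) = L y := fun y => congr($(h.mul_mul_inv) y)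
  have hP : ∀ y z, ⟪L (T.op y), z⟫_ℂ = ⟪y, L (T.op z)⟫_ℂ := fun y z => by
    have := ContinuousLinearMap.adjoint_inner_left (L ∘L T.op) z y
    rwa [h.adjoint_right] at this
  have hQ : ∀ y z, ⟪T.op (L y), z⟫_ℂ = ⟪y, T.op (L z)⟫_ℂ := fun y z => by
    have := ContinuousLinearMap.adjoint_inner_left (T.op ∘L L) z y
    rwa [h.adjoint_left] at this
  have hP1 : ∀ b y, L (T.op (R.σ b (L (T.op y)))) = L (T.op (R.σ b y)) := fun b y => by
    rw [T.comm, hT, T.comm]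
  have hQ1 : ∀ b y, T.op (L (S.σ b (T.op (L y)))) = S.σ b (T.op (L y)) := fun b y => by
    rw [← T.comm, hT]
  have hP2 : ∀ y, L (T.op (R.σ b y)) = R.σ b (L (T.op y)) := fun y => by
    refine ext_inner_right ℂ fun z => ?_
    rw [← hP1, hP, Intertwiner.inner_σ, hP, hP1, Intertwiner.inner_σ, hP]
  have hQ2 : ∀ y, T.op (L (S.σ b y)) = S.σ b (T.op (L y)) := fun y => by
    refine ext_inner_right ℂ fun z => ?_
    rw [hQ, Intertwiner.inner_σ, ← hQ1 (star b) z, ← hQ, ← Intertwiner.inner_σ, ← hQ, hQ1]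
  rw [← hL, hQ2, ← T.comm, hP2, hL]

open scoped Classical in
/-- The Moore-Penrose inverse `T†` of an intertwining operator `T`; it exists precisely when the
range of `T` is closed (and is set to be `0` otherwise). -/
noncomputable def Intertwiner.pinv (T : Intertwiner R S) : Intertwiner S R :=
  if h : ∃ L, IsMoorePenrose T.op L then ⟨h.choose, h.choose_spec.comm⟩
  else ⟨0, fun b x => by simp⟩

end MoorePenrose

/-! ### The tensor powers, iterates and the generalized range -/

section Tower

variable {B : Type u} [NonUnitalCStarAlgebra B] [PartialOrder B] [StarOrderedRing B]
variable (E : Type v) [NormedAddCommGroup E] [NormedSpace ℂ E] [SMul Bᵐᵒᵖ E] [CStarModule Bᵐᵒᵖ E]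
variable [CStarCorrespondence B E]

/-- The representation `φ_n ⊗ I` on `E^{⊗ n} ⊗ H = E ⊗ (E ⊗ ⋯ (E ⊗ H))`. -/
noncomputable def tensorPow : ℕ → StarRep.{u, v} B → StarRep.{u, v} B
  | 0, R => R
  | n + 1, R => tensorPow n (interior E R)

variable {R S : StarRep.{u, v} B}

/-- The operator `I_{E^{⊗ n}} ⊗ T : E^{⊗ n} ⊗ H → E^{⊗ n} ⊗ K`. -/
noncomputable def powMap : (n : ℕ) → {R S : StarRep.{u, v} B} → Intertwiner R S →
    Intertwiner (tensorPow E n R) (tensorPow E n S)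
  | 0, _, _, T => T
  | n + 1, _, _, T => powMap n (interiorMap (E := E) T)

variable {E}

/-- The subspace `E ⊗ K` of `E ⊗ H`, for a subspace `K` of `H`: the closed linear span of the
tensors `ξ ⊗ k` with `k ∈ K`. -/
noncomputable def tensorSubspace (E : Type v) [NormedAddCommGroup E] [NormedSpace ℂ E]
    [SMul Bᵐᵒᵖ E] [CStarModule Bᵐᵒᵖ E] [CStarCorrespondence B E] {R : StarRep.{u, v} B}
    (K : Submodule ℂ R) : Submodule ℂ (interior E R) :=
  (Submodule.span ℂ {x | ∃ (ξ : E) (k : R), k ∈ K ∧ x = tprod ξ k}).topologicalClosure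

variable (E) in
/-- The subspace `E^{⊗ n} ⊗ K` of `E^{⊗ n} ⊗ H`. -/
noncomputable def powSubspace : (n : ℕ) → {R : StarRep.{u, v} B} → Submodule ℂ R →
    Submodule ℂ (tensorPow E n R)
  | 0, _, K => K
  | n + 1, _, K => powSubspace n (tensorSubspace E K)

/-- The operators `Ṽ_n : E^{⊗ n} ⊗ H → H`, `Ṽ_n (ξ₁ ⊗ ⋯ ⊗ ξ_n ⊗ h) = V ξ₁ ⋯ V ξ_n h`. -/
noncomputable def iter (T : Intertwiner (interior E R) R) :
    (n : ℕ) → Intertwiner (tensorPow E n R) R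
  | 0 => Intertwiner.id R
  | n + 1 => (iter T n).comp (powMap E n T)

/-- The operators `S⁽ⁿ⁾ = (I_{E^{⊗ (n-1)}} ⊗ S) ⋯ (I_E ⊗ S) S : H → E^{⊗ n} ⊗ H`. -/
noncomputable def coiter (S : Intertwiner R (interior E R)) :
    (n : ℕ) → Intertwiner R (tensorPow E n R)
  | 0 => Intertwiner.id R
  | n + 1 => (powMap E n S).comp (coiter S n)

/-- The range of a bounded intertwining operator. -/
def Intertwiner.range (T : Intertwiner R S) : Submodule ℂ S := LinearMap.range T.op.toLinearMap

/-- The kernel of a bounded intertwining operator. -/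
def Intertwiner.ker (T : Intertwiner R S) : Submodule ℂ R := LinearMap.ker T.op.toLinearMap

/-- The generalized range `R^∞(Ṽ) = ⋂ n, R(Ṽ_n)`. -/
noncomputable def genRange (T : Intertwiner (interior E R) R) : Submodule ℂ R :=
  ⨅ n : ℕ, (iter T n).range

/-- The closed subspace `[K]_Ṽ = ⋁ n, Ṽ_n (E^{⊗ n} ⊗ K)` generated by a subspace `K`. -/
noncomputable def generated (T : Intertwiner (interior E R) R) (K : Submodule ℂ R) :
    Submodule ℂ R :=
  (⨆ n : ℕ, (powSubspace E n K).map (iter T n).op.toLinearMap).topologicalClosure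

/-- The operator `Ṽ' = Ṽ (Ṽ* Ṽ)†` of the Cauchy dual. -/
noncomputable def cauchyDual (T : Intertwiner (interior E R) R) : Intertwiner (interior E R) R :=
  T.comp (T.adjoint.comp T).pinv

/-- `(σ, V)` is regular: `R(Ṽ)` is closed and `N(Ṽ) ⊆ E ⊗ R^∞(Ṽ)`. -/
def CBCRep.IsRegular (π : CBCRep E R) : Prop :=
  IsClosed (π.tilde.range : Set R) ∧ π.tilde.ker ≤ tensorSubspace E (genRange π.tilde)

/-- `(σ, V)` is bi-regular: it is regular and `N(I_{E^{⊗ n}} ⊗ Ṽ†) ⊆ R(Ṽ†⁽ⁿ⁾)` for all `n ≥ 1`. -/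
def CBCRep.IsBiregular (π : CBCRep E R) : Prop :=
  π.IsRegular ∧ ∀ n : ℕ, 1 ≤ n → (powMap E n π.tilde.pinv).ker ≤ (coiter π.tilde.pinv n).range

/-- `H = M ⊕ N`: the Hilbert space `H` is the orthogonal direct sum of its subspaces `M`, `N`. -/
def IsOrthogonalSum {H : Type*} [NormedAddCommGroup H] [InnerProductSpace ℂ H]
    (M N : Submodule ℂ H) : Prop :=
  M ⟂ N ∧ M ⊔ N = ⊤

end Tower

end CovariantRep

namespace CovariantRep

/-! ### Adjoints and composition of intertwining operators. -/

namespace Intertwiner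

variable {B : Type u} [NonUnitalCStarAlgebra B] {R S T : StarRep.{u, v} B}

/-! Write `T` for Ṽ, `S = T†`, and `Q = I - T S`, the orthogonal projection onto the wandering space
R(T)^⊥. The Cauchy dual of `T` is `S*` (`cauchyDual_eq_adjoint_pinv`), and since `T S` is
self-adjoint, the identity `T S + Q = I` also reads `S* T* + Q = I`. The pairs `(T, S)` and `(S*,
T*)` therefore play symmetric roles.

Since E^{⊗n} ⊗ R(Q) is the range of `I ⊗ Q`, taking adjoints shows that `x` is orthogonal to the
subspace generated by R(Q) under `T` exactly when `(I ⊗ Q) T*⁽ⁿ⁾ x = 0` for all `n`; under `S*` the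
condition is `(I ⊗ Q) S⁽ⁿ⁾ x = 0` (`mem_orthogonal_generated`). It remains to identify these two
orthogonal complements with the generalized ranges of `S*` and `T` respectively.

One inclusion is a telescoping argument: inserting `T S + Q = I` at each level gives `T_n S⁽ⁿ⁾ x =
x` once all the terms `(I ⊗ Q) S⁽ⁿ⁾ x` vanish, so `x` lies in every R(T_n); the same holds for the
dual pair (`iter_coiter_of_forall`).

The other inclusion asks for one operator identity on each side. For the range of `T` it is `(I ⊗ Q)
S⁽ⁿ⁾ T_{n+1} = 0`, which follows from N(T) ⊆ E ⊗ R^∞(T) (`powMap_coiter_iter_succ`). For the range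
of `S*` it is, after passing to adjoints, `S⁽ⁿ⁺¹⁾ T_n (I ⊗ Q) = 0`, which follows from the kernel
condition on `I ⊗ T†` (`coiter_iter_powMap`). -/

lemma ext_apply {f g : Intertwiner R S} (h : ∀ x, f.op x = g.op x) : f = g := by
  cases f
  cases g
  congr 1
  exact ContinuousLinearMap.ext h

lemma comp_apply (g : Intertwiner S T) (f : Intertwiner R S) (x : R) :
    (g.comp f).op x = g.op (f.op x) := rfl

lemma id_apply (x : R) : (Intertwiner.id R).op x = x := rfl

lemma adjoint_inner_left (f : Intertwiner R S) (x : R) (y : S) :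
    ⟪f.adjoint.op y, x⟫_ℂ = ⟪y, f.op x⟫_ℂ :=
  ContinuousLinearMap.adjoint_inner_left f.op x y

lemma adjoint_inner_right (f : Intertwiner R S) (x : R) (y : S) :
    ⟪x, f.adjoint.op y⟫_ℂ = ⟪f.op x, y⟫_ℂ :=
  ContinuousLinearMap.adjoint_inner_right f.op x y

lemma eq_adjoint {f : Intertwiner R S} {g : Intertwiner S R}
    (h : ∀ x y, ⟪f.op x, y⟫_ℂ = ⟪x, g.op y⟫_ℂ) : g = f.adjoint :=
  ext_apply fun y => ext_inner_left ℂ fun x => by rw [adjoint_inner_right, h]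

lemma adjoint_adjoint (f : Intertwiner R S) : f.adjoint.adjoint = f :=
  (eq_adjoint fun y x => f.adjoint_inner_left x y).symm

lemma adjoint_comp (g : Intertwiner S T) (f : Intertwiner R S) :
    (g.comp f).adjoint = f.adjoint.comp g.adjoint :=
  (eq_adjoint fun x y => by
    rw [comp_apply, comp_apply, adjoint_inner_right, adjoint_inner_right]).symm

lemma adjoint_id : (Intertwiner.id R).adjoint = Intertwiner.id R :=
  (eq_adjoint fun _ _ => rfl).symm

/-- The operator `I - f` of an intertwining operator `f`. -/
def compl (f : Intertwiner R R) : Intertwiner R R :=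
  ⟨ContinuousLinearMap.id ℂ R - f.op, fun b x => by simp [f.comm]⟩

end Intertwiner

/-! ### Functoriality of `I ⊗ T`, and orthogonal complements of generated subspaces. -/

section Functoriality

variable {B : Type u} [NonUnitalCStarAlgebra B] [PartialOrder B] [StarOrderedRing B]
variable {E : Type v} [NormedAddCommGroup E] [NormedSpace ℂ E] [SMul Bᵐᵒᵖ E] [CStarModule Bᵐᵒᵖ E]
variable [CStarCorrespondence B E]
variable {R S T : StarRep.{u, v} B}

open Intertwiner

lemma tprod_add (ξ : E) (h k : R) : tprod ξ (h + k) = tprod ξ h + tprod ξ k := by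
  unfold tprod
  rw [← map_add]
  exact congrArg _ (TensorProduct.tmul_add _ _ _)

lemma interiorMap_comp (g : Intertwiner S T) (f : Intertwiner R S) :
    interiorMap (E := E) (g.comp f) = (interiorMap g).comp (interiorMap f) :=
  ext_apply fun x => by
    suffices h : (interiorMap (E := E) (g.comp f)).op =
        ((interiorMap (E := E) g).comp (interiorMap f)).op from congr($h x)
    refine interior_ext fun ξ h => ?_
    simp only [comp_apply, interiorMap_tprod]

lemma interiorMap_id : interiorMap (E := E) (Intertwiner.id R) = Intertwiner.id _ :=
  ext_apply fun x => by
    suffices h : (interiorMap (E := E) (Intertwiner.id R)).op = (Intertwiner.id _).op from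
      congr($h x)
    refine interior_ext fun ξ h => ?_
    simp only [Intertwiner.id_apply, interiorMap_tprod]

lemma interiorMap_add {f g h : Intertwiner R S} (H : ∀ x, f.op x = g.op x + h.op x)
    (x : interior E R) :
    (interiorMap f).op x = (interiorMap g).op x + (interiorMap h).op x := by
  suffices h : (interiorMap (E := E) f).op = (interiorMap g).op + (interiorMap h).op from
    congr($h x)
  refine interior_ext fun ξ k => ?_
  rw [_root_.add_apply, interiorMap_tprod, interiorMap_tprod, interiorMap_tprod, H, tprod_add]

/-- On elementary tensors both sides are inner products twisted by `σ ⟪ξ, η⟫`, and `f` passes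
through `σ` because it intertwines. Density of the span of the tensors, applied in each variable in
turn, does the rest. -/
lemma inner_interiorMap (f : Intertwiner R S) (x : interior E R) (y : interior E S) :
    ⟪(interiorMap f).op x, y⟫_ℂ = ⟪x, (interiorMap f.adjoint).op y⟫_ℂ := by
  rw [← Intertwiner.adjoint_inner_right]
  suffices h : (interiorMap (E := E) f).adjoint.op = (interiorMap f.adjoint).op by rw [h]
  refine interior_ext fun η k => ext_inner_left ℂ fun x => ?_
  rw [Intertwiner.adjoint_inner_right, interiorMap_tprod]
  rw [← inner_conj_symm, ← inner_conj_symm x]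
  congr 1
  suffices h : (innerSL ℂ (tprod η k)).comp (interiorMap (E := E) f).op =
      innerSL ℂ (tprod η (f.adjoint.op k)) from congr($h x)
  refine interior_ext fun ξ h => ?_
  simp only [ContinuousLinearMap.comp_apply, innerSL_apply_apply, interiorMap_tprod, inner_tprod]
  rw [← f.comm, Intertwiner.adjoint_inner_left]

lemma interiorMap_adjoint (f : Intertwiner R S) :
    interiorMap (E := E) f.adjoint = (interiorMap f).adjoint :=
  eq_adjoint (inner_interiorMap f)

lemma powMap_comp (n : ℕ) : ∀ {R S T : StarRep.{u, v} B} (g : Intertwiner S T)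
    (f : Intertwiner R S), powMap E n (g.comp f) = (powMap E n g).comp (powMap E n f) := by
  induction n with
  | zero => intros; rfl
  | succ n ih => intro R S T g f; simp only [powMap, interiorMap_comp, ih]; rfl

lemma powMap_add (n : ℕ) : ∀ {R S : StarRep.{u, v} B} {f g h : Intertwiner R S}
    (_ : ∀ x, f.op x = g.op x + h.op x) (x : tensorPow E n R),
    (powMap E n f).op x = (powMap E n g).op x + (powMap E n h).op x := by
  induction n with
  | zero => intro R S f g h H; exact H
  | succ n ih => intro R S f g h H; exact ih (interiorMap_add H)

lemma powMap_id (n : ℕ) : ∀ {R : StarRep.{u, v} B} (x : tensorPow E n R),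
    (powMap E n (Intertwiner.id R)).op x = x := by
  induction n with
  | zero => intro R x; rfl
  | succ n ih => intro R x; simp only [powMap, interiorMap_id]; exact ih x

lemma powMap_zero (n : ℕ) {f : Intertwiner R S} (H : ∀ x, f.op x = 0)
    (x : tensorPow E n R) : (powMap E n f).op x = 0 := by
  -- A vanishing `f` satisfies `f = f + f`, so additivity gives the same for `I ⊗ f`, which is
  -- therefore zero.
  have := powMap_add n (f := f) (g := f) (h := f) (fun y => by simp [H]) x
  simpa using this

lemma powMap_adjoint (n : ℕ) : ∀ {R S : StarRep.{u, v} B} (f : Intertwiner R S),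
    powMap E n f.adjoint = (powMap E n f).adjoint := by
  induction n with
  | zero => intros; rfl
  | succ n ih => intro R S f; simp only [powMap, interiorMap_adjoint, ih]; rfl

lemma iter_adjoint (T : Intertwiner (interior E R) R) (n : ℕ) :
    (iter T n).adjoint = coiter T.adjoint n := by
  induction n with
  | zero => exact adjoint_id
  | succ n ih =>
    refine (adjoint_comp (iter T n) (powMap E n T)).trans ?_
    rw [ih, ← powMap_adjoint]
    rfl

/-- The subspace `E ⊗ R(Q)` is the range of `I ⊗ Q`, for an idempotent `Q`. -/
lemma tensorSubspace_range {Q : Intertwiner R R} (hQ : Q.comp Q = Q) :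
    tensorSubspace E Q.range = (interiorMap (E := E) Q).range := by
  have hidem : ∀ y, (interiorMap (E := E) Q).op ((interiorMap (E := E) Q).op y) =
      (interiorMap (E := E) Q).op y := fun y => by
    rw [← comp_apply, ← interiorMap_comp, hQ]
  -- The range of an idempotent is its set of fixed points and hence closed, so it contains the
  -- closure that defines `E ⊗ R(Q)`.
  have hrange : ((interiorMap (E := E) Q).range : Set (interior E R)) =
      {x | (interiorMap (E := E) Q).op x = x} := by
    ext x
    constructor
    · rintro ⟨y, rfl⟩
      exact hidem y
    · intro h
      exact ⟨x, h⟩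
  apply le_antisymm
  · refine Submodule.topologicalClosure_minimal _ ?_ ?_
    · refine Submodule.span_le.2 ?_
      rintro _ ⟨ξ, _, ⟨k, rfl⟩, rfl⟩
      exact ⟨tprod ξ k, interiorMap_tprod Q ξ k⟩
    · rw [hrange]
      exact isClosed_eq (interiorMap (E := E) Q).op.continuous continuous_id
  · rintro _ ⟨y, rfl⟩
    refine UniformSpace.Completion.induction_on (p := fun y =>
      (interiorMap (E := E) Q).op y ∈ tensorSubspace E Q.range) y ?_ ?_
    · exact (Submodule.isClosed_topologicalClosure _).preimage
        (interiorMap (E := E) Q).op.continuous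
    · intro a
      change (interiorMap (E := E) Q).op (incl E R a) ∈ tensorSubspace E Q.range
      induction a using PreTensor.induction with
      | zero => rw [map_zero, map_zero]; exact zero_mem _
      | add x y hx hy => rw [map_add, map_add]; exact add_mem hx hy
      | tmul ξ h =>
        refine Submodule.le_topologicalClosure _ (Submodule.subset_span ⟨ξ, Q.op h, ⟨h, rfl⟩, ?_⟩)
        exact interiorMap_tprod Q ξ h

lemma powSubspace_range (n : ℕ) : ∀ {R : StarRep.{u, v} B} {Q : Intertwiner R R}
    (_ : Q.comp Q = Q), powSubspace E n Q.range = (powMap E n Q).range := by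
  induction n with
  | zero => intros; rfl
  | succ n ih =>
    intro R Q hQ
    rw [powSubspace, tensorSubspace_range hQ, powMap]
    exact ih (by rw [← interiorMap_comp, hQ])

/-- `I_E ⊗ f` vanishes on `E ⊗ K` if `f` vanishes on `K`. -/
lemma interiorMap_eq_zero {f : Intertwiner R S} {K : Submodule ℂ R} (h : ∀ x ∈ K, f.op x = 0)
    {x : interior E R} (hx : x ∈ tensorSubspace E K) : (interiorMap f).op x = 0 := by
  have hle : tensorSubspace E K ≤ (interiorMap (E := E) f).ker := by
    refine Submodule.topologicalClosure_minimal _ (Submodule.span_le.2 ?_)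
      (ContinuousLinearMap.isClosed_ker _)
    rintro _ ⟨ξ, k, hk, rfl⟩
    change (interiorMap (E := E) f).op (tprod ξ k) = 0
    rw [interiorMap_tprod, h k hk]
    have := tprod_add (R := S) ξ 0 0
    simpa using this
  exact hle hx

/-- Orthogonality to `T_n (I ⊗ Q) z` for all `z` moves, by adjunction, to the vanishing of `(I ⊗ Q)
T*⁽ⁿ⁾ x`. This turns a statement about closed spans into a family of equations. -/
lemma mem_orthogonal_generated (T : Intertwiner (interior E R) R) {Q : Intertwiner R R}
    (hQ : Q.comp Q = Q) (hadj : Q.adjoint = Q) (x : R) :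
    x ∈ (generated T Q.range)ᗮ ↔
      ∀ n, (powMap E n Q).op ((coiter T.adjoint n).op x) = 0 := by
  rw [generated, Submodule.orthogonal_closure, ← Submodule.iInf_orthogonal, Submodule.mem_iInf]
  refine forall_congr' fun n => ?_
  have hinner : ∀ z, ⟪(iter T n).op ((powMap E n Q).op z), x⟫_ℂ =
      ⟪z, (powMap E n Q).op ((coiter T.adjoint n).op x)⟫_ℂ := fun z => by
    rw [← iter_adjoint, ← congrArg (powMap E n) hadj, powMap_adjoint,
      Intertwiner.adjoint_inner_right, Intertwiner.adjoint_inner_right, ← powMap_adjoint, hadj]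
  rw [powSubspace_range n hQ, Submodule.mem_orthogonal]
  constructor
  · intro h
    -- The test vector `z` is `(I ⊗ Q) T*⁽ⁿ⁾ x` itself.
    refine inner_self_eq_zero.1 ((hinner _).symm.trans (h _ ⟨_, ⟨_, rfl⟩, rfl⟩))
  · rintro h _ ⟨_, ⟨z, rfl⟩, rfl⟩
    refine (hinner z).trans ?_
    rw [h, inner_zero_right]

end Functoriality

/-! ### Existence and uniqueness of Moore–Penrose inverses. -/

section MoorePenroseExistence

variable {H K : Type v} [NormedAddCommGroup H] [InnerProductSpace ℂ H] [CompleteSpace H]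
  [NormedAddCommGroup K] [InnerProductSpace ℂ K] [CompleteSpace K]

/-- `T S` and `T S'` are self-adjoint idempotents with the same range R(T), hence equal; dually `S T
= S' T`. Then `S = S T S = S' T S' = S'`. -/
lemma IsMoorePenrose.unique {T : H →L[ℂ] K} {S S' : K →L[ℂ] H} (h : IsMoorePenrose T S)
    (h' : IsMoorePenrose T S') : S = S' := by
  have e1 : T ∘L S = T ∘L S' := by
    rw [← h.adjoint_left, ← h'.adjoint_left]
    have : T ∘L S = (T ∘L S') ∘L (T ∘L S) := by
      conv_lhs => rw [← h'.mul_mul_self]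
      rfl
    conv_lhs => rw [this, ContinuousLinearMap.adjoint_comp, h.adjoint_left, h'.adjoint_left]
    have h2 : (T ∘L S) ∘L (T ∘L S') = T ∘L S' := by
      conv_rhs => rw [← h.mul_mul_self]
      rfl
    rw [h2, h'.adjoint_left]
  have e2 : S ∘L T = S' ∘L T := by
    rw [← h.adjoint_right, ← h'.adjoint_right]
    have : S ∘L T = (S ∘L T) ∘L (S' ∘L T) := by
      conv_lhs => rw [← h'.mul_mul_self]
      rfl
    conv_lhs => rw [this, ContinuousLinearMap.adjoint_comp, h.adjoint_right, h'.adjoint_right]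
    have h2 : (S' ∘L T) ∘L (S ∘L T) = S' ∘L T := by
      conv_rhs => rw [← h.mul_mul_self]
      rfl
    rw [h2, h'.adjoint_right]
  calc S = S ∘L (T ∘L S) := h.mul_mul_inv.symm
    _ = (S ∘L T) ∘L S' := by rw [e1]; rfl
    _ = S' ∘L T ∘L S' := by rw [e2]; rfl
    _ = S' := h'.mul_mul_inv

/-- An operator with closed range has a Moore-Penrose inverse. -/
lemma exists_isMoorePenrose (T : H →L[ℂ] K) (hT : IsClosed (T.range : Set K)) :
    ∃ S, IsMoorePenrose T S := by
  have hk : IsClosed (T.ker : Set H) := T.isClosed_ker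
  have : CompleteSpace T.ker := hk.completeSpace_coe
  have : CompleteSpace T.range := hT.completeSpace_coe
  have hmem : ∀ x : T.kerᗮ, T x ∈ T.range := fun x => ⟨x, rfl⟩
  let f : T.kerᗮ →L[ℂ] T.range := (T.comp T.kerᗮ.subtypeL).codRestrict T.range hmem
  have hproj : ∀ x, T (T.kerᗮ.orthogonalProjectionOnto x) = T x := fun x => by
    have h1 : x - T.kerᗮ.orthogonalProjectionOnto x ∈ T.kerᗮᗮ :=
      Submodule.sub_starProjection_mem_orthogonal x
    rw [Submodule.orthogonal_orthogonal] at h1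
    have h2 : T (x - T.kerᗮ.orthogonalProjectionOnto x) = 0 := h1
    rw [map_sub, sub_eq_zero] at h2
    exact h2.symm
  have hinj : f.ker = ⊥ := by
    rw [Submodule.eq_bot_iff]
    intro x hx
    have h1 : T x = 0 := congrArg Subtype.val hx
    have h2 : (x : H) ∈ T.ker := h1
    have h3 := Submodule.inner_left_of_mem_orthogonal h2 x.2
    exact Subtype.ext (inner_self_eq_zero.1 h3)
  have hsurj : f.range = ⊤ := by
    rw [Submodule.eq_top_iff']
    rintro ⟨_, x, rfl⟩
    exact ⟨T.kerᗮ.orthogonalProjectionOnto x, Subtype.ext (hproj x)⟩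
  -- Closedness of R(T) enters here: N(T)^⊥ → R(T) is a bijection of complete spaces, so its inverse
  -- is bounded by the open mapping theorem. `S` is this inverse after projection onto R(T).
  let e := ContinuousLinearEquiv.ofBijective f hinj hsurj
  let S : K →L[ℂ] H := T.kerᗮ.subtypeL ∘L (e.symm : T.range →L[ℂ] T.kerᗮ) ∘L
    T.range.orthogonalProjectionOnto
  have hTS : ∀ y, T (S y) = T.range.orthogonalProjectionOnto y := fun y =>
    congrArg Subtype.val (e.apply_symm_apply (T.range.orthogonalProjectionOnto y))
  have hST : ∀ x, S (T x) = T.kerᗮ.orthogonalProjectionOnto x := fun x => by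
    have h1 : T.range.orthogonalProjectionOnto (T x) =
        e (T.kerᗮ.orthogonalProjectionOnto x) := by
      refine Subtype.ext ?_
      have h2 : T.range.orthogonalProjectionOnto (T x) = ⟨T x, x, rfl⟩ :=
        Submodule.orthogonalProjectionOnto_mem_subspace_eq_self (K := T.range) ⟨T x, x, rfl⟩
      rw [h2]
      exact (hproj x).symm
    change ((e.symm (T.range.orthogonalProjectionOnto (T x)) : T.kerᗮ) : H) = _
    rw [h1, e.symm_apply_apply]
  have hTS' : T ∘L S = T.range.subtypeL ∘L T.range.orthogonalProjectionOnto :=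
    ContinuousLinearMap.ext hTS
  have hST' : S ∘L T = T.kerᗮ.subtypeL ∘L T.kerᗮ.orthogonalProjectionOnto :=
    ContinuousLinearMap.ext hST
  refine ⟨S, ?_, ?_, ?_, ?_⟩
  · ext x
    change T (S (T x)) = T x
    rw [hST, hproj]
  · ext y
    change S (T (S y)) = S y
    rw [hST]
    exact congrArg Subtype.val (Submodule.orthogonalProjectionOnto_mem_subspace_eq_self
      (e.symm (T.range.orthogonalProjectionOnto y)))
  · rw [hTS']
    exact (ContinuousLinearMap.eq_adjoint_iff _ _).2 (fun x y =>
      Submodule.inner_starProjection_left_eq_right T.range x y) |>.symm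
  · rw [hST']
    exact (ContinuousLinearMap.eq_adjoint_iff _ _).2 (fun x y =>
      Submodule.inner_starProjection_left_eq_right T.kerᗮ x y) |>.symm

/-- From `T* T S = T*` and `T* S* = (S T)* = S T`, both products of `T* T` with `S S*` collapse to
the projection `S T`. -/
lemma IsMoorePenrose.adjoint_comp_self {T : H →L[ℂ] K} {S : K →L[ℂ] H} (h : IsMoorePenrose T S) :
    IsMoorePenrose (ContinuousLinearMap.adjoint T ∘L T)
      (S ∘L ContinuousLinearMap.adjoint S) := by
  have e1 : ContinuousLinearMap.adjoint T ∘L (T ∘L S) = ContinuousLinearMap.adjoint T := by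
    rw [← h.adjoint_left, ← ContinuousLinearMap.adjoint_comp]
    exact congrArg _ h.mul_mul_self
  have e2 : ContinuousLinearMap.adjoint T ∘L ContinuousLinearMap.adjoint S = S ∘L T := by
    rw [← ContinuousLinearMap.adjoint_comp, h.adjoint_right]
  have e3 : ContinuousLinearMap.adjoint S ∘L ContinuousLinearMap.adjoint T = T ∘L S := by
    rw [← ContinuousLinearMap.adjoint_comp, h.adjoint_left]
  have e4 : (ContinuousLinearMap.adjoint T ∘L T) ∘L (S ∘L ContinuousLinearMap.adjoint S) =
      S ∘L T := by
    calc _ = (ContinuousLinearMap.adjoint T ∘L (T ∘L S)) ∘L ContinuousLinearMap.adjoint S := rfl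
      _ = S ∘L T := by rw [e1, e2]
  have e5 : (S ∘L ContinuousLinearMap.adjoint S) ∘L (ContinuousLinearMap.adjoint T ∘L T) =
      S ∘L T := by
    have : (S ∘L ContinuousLinearMap.adjoint S) ∘L (ContinuousLinearMap.adjoint T ∘L T) =
      S ∘L (ContinuousLinearMap.adjoint S ∘L ContinuousLinearMap.adjoint T) ∘L T := rfl
    rw [this, e3]
    exact congrArg (S ∘L ·) h.mul_mul_self
  refine ⟨?_, ?_, ?_, ?_⟩
  · rw [e5]
    exact congrArg (ContinuousLinearMap.adjoint T ∘L ·) h.mul_mul_self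
  · rw [← ContinuousLinearMap.comp_assoc, e5]
    exact congrArg (· ∘L ContinuousLinearMap.adjoint S) h.mul_mul_inv
  · rw [e4, h.adjoint_right]
  · rw [e5, h.adjoint_right]

variable {B : Type u} [NonUnitalCStarAlgebra B] {R S : StarRep.{u, v} B}

lemma Intertwiner.isMoorePenrose_pinv {T : Intertwiner R S} (h : ∃ L, IsMoorePenrose T.op L) :
    IsMoorePenrose T.op T.pinv.op := by
  rw [Intertwiner.pinv, dif_pos h]
  exact h.choose_spec

end MoorePenroseExistence

/-! ### The Cauchy dual, and splitting off the outermost tensor factor. -/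

section Wold

variable {B : Type u} [NonUnitalCStarAlgebra B] [PartialOrder B] [StarOrderedRing B]
variable {E : Type v} [NormedAddCommGroup E] [NormedSpace ℂ E] [SMul Bᵐᵒᵖ E] [CStarModule Bᵐᵒᵖ E]
variable [CStarCorrespondence B E]
variable {R : StarRep.{u, v} B}

open Intertwiner

/-- `Ṽ' = (Ṽ†)*`. -/
lemma cauchyDual_eq_adjoint_pinv {T : Intertwiner (interior E R) R}
    (h : IsMoorePenrose T.op T.pinv.op) : cauchyDual T = T.pinv.adjoint := by
  have h1 : IsMoorePenrose (T.adjoint.comp T).op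
      (T.pinv.op ∘L ContinuousLinearMap.adjoint T.pinv.op) := h.adjoint_comp_self
  have h2 := (Intertwiner.isMoorePenrose_pinv ⟨_, h1⟩).unique h1
  refine ext_apply fun x => ?_
  rw [cauchyDual, Intertwiner.comp_apply, h2]
  refine ext_inner_right ℂ fun y => ?_
  have h3 := ContinuousLinearMap.adjoint_inner_left (T.op ∘L T.pinv.op) y
    (T.pinv.adjoint.op x)
  rw [h.adjoint_left] at h3
  refine h3.trans ?_
  rw [Intertwiner.adjoint_inner_left, Intertwiner.adjoint_inner_left]
  exact congrArg (inner ℂ x) congr($(h.mul_mul_inv) y)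

/-- The canonical isomorphism `E^{⊗ n} ⊗ (E ⊗ H) ≅ E ⊗ (E^{⊗ n} ⊗ H)`. -/
noncomputable def shift : (n : ℕ) → (R : StarRep.{u, v} B) →
    Intertwiner (tensorPow E n (interior E R)) (interior E (tensorPow E n R))
  | 0, R => Intertwiner.id (interior E R)
  | n + 1, R => shift n (interior E R)

lemma shift_injective (n : ℕ) : ∀ {R : StarRep.{u, v} B} {x : tensorPow E n (interior E R)},
    (shift n R).op x = 0 → x = 0 := by
  induction n with
  | zero => exact fun h => h
  | succ n ih => exact fun h => ih h

lemma shift_powMap (n : ℕ) : ∀ {R S : StarRep.{u, v} B} (f : Intertwiner R S)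
    (x : tensorPow E n (interior E R)),
    (shift n S).op ((powMap E (n + 1) f).op x) = (interiorMap (powMap E n f)).op ((shift n R).op x)
    := by
  induction n with
  | zero => intros; rfl
  | succ n ih => intro R S f x; exact ih (interiorMap f) x

/-- The recursion of `coiter` adds its new factor `E` next to `H`. An induction on the regularity
condition needs `S⁽ⁿ⁺¹⁾ = (I_E ⊗ S⁽ⁿ⁾) S` instead, with the outermost factor split off; `shift`
mediates between the two. -/
lemma shift_coiter (S : Intertwiner R (interior E R)) (n : ℕ) (x : R) :
    (shift n R).op ((coiter S (n + 1)).op x) = (interiorMap (coiter S n)).op (S.op x) := by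
  induction n with
  | zero =>
    change S.op x = (interiorMap (Intertwiner.id R)).op (S.op x)
    rw [interiorMap_id]
    rfl
  | succ n ih =>
    refine (shift_powMap n S ((coiter S (n + 1)).op x)).trans ?_
    rw [ih, ← Intertwiner.comp_apply, ← interiorMap_comp]
    rfl

/-- The counterpart of `shift_coiter` for the iterates: `T_{n+1} = T (I_E ⊗ T_n)`. -/
lemma iter_succ_eq_shift (T : Intertwiner (interior E R) R) (n : ℕ)
    (x : tensorPow E n (interior E R)) :
    (iter T (n + 1)).op x = T.op ((interiorMap (iter T n)).op ((shift n R).op x)) := by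
  induction n with
  | zero =>
    change T.op x = T.op ((interiorMap (Intertwiner.id R)).op x)
    rw [interiorMap_id]
    rfl
  | succ n ih =>
    refine (ih ((powMap E (n + 1) T).op x)).trans (congrArg T.op ?_)
    refine (congrArg (interiorMap (iter T n)).op (shift_powMap n T x)).trans ?_
    rw [← Intertwiner.comp_apply, ← interiorMap_comp]
    rfl

/-! ### Consequences of the splitting `T S + Q = I`. -/

section Splitting

variable {T : Intertwiner (interior E R) R} {S : Intertwiner R (interior E R)}
  {Q : Intertwiner R R}

/-- If `T S + Q = I` then `T_n S⁽ⁿ⁾ = T_{n+1} S⁽ⁿ⁺¹⁾ + T_n (I ⊗ Q) S⁽ⁿ⁾`. -/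
lemma iter_coiter_succ (hTS : ∀ x, x = T.op (S.op x) + Q.op x) (n : ℕ) (x : R) :
    (iter T n).op ((coiter S n).op x) = (iter T (n + 1)).op ((coiter S (n + 1)).op x) +
      (iter T n).op ((powMap E n Q).op ((coiter S n).op x)) := by
  have h := powMap_add (E := E) n (f := Intertwiner.id R) (g := T.comp S) (h := Q) hTS
    ((coiter S n).op x)
  rw [powMap_id, powMap_comp, Intertwiner.comp_apply] at h
  conv_lhs => rw [h, map_add]
  rfl

/-- The error terms in `iter_coiter_succ` all vanish, so `T_n S⁽ⁿ⁾ x` does not depend on `n`. This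
exhibits `x` as an element of every R(T_n). -/
lemma iter_coiter_of_forall (hTS : ∀ x, x = T.op (S.op x) + Q.op x) {x : R}
    (hx : ∀ n, (powMap E n Q).op ((coiter S n).op x) = 0) (n : ℕ) :
    (iter T n).op ((coiter S n).op x) = x := by
  induction n with
  | zero => rfl
  | succ n ih =>
    have h := iter_coiter_succ hTS n x
    rw [hx, map_zero, add_zero, ih] at h
    exact h.symm

lemma coiter_eq_zero_of_le {m n : ℕ} (hmn : m ≤ n) {x : R} (hx : (coiter S m).op x = 0) :
    (coiter S n).op x = 0 := by
  induction hmn with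
  | refl => exact hx
  | @step k _ ih => exact (congrArg (powMap E k S).op ih).trans (map_zero _)

/-- The kernel condition writes `(I ⊗ Q) x`, which `I ⊗ S` kills, as `S⁽ⁿ⁾ f`. It then suffices that
`S⁽ⁿ⁾ T_n S⁽ⁿ⁾ f = S⁽ⁿ⁾ f`, and this follows by telescoping from `m = 0` to `m = n`. -/
lemma coiter_iter_powMap (hTS : ∀ x, x = T.op (S.op x) + Q.op x) (hSQ : ∀ x, S.op (Q.op x) = 0)
    (hS : ∀ n, 1 ≤ n → (powMap E n S).ker ≤ (coiter S n).range) (n : ℕ) (x : tensorPow E n R) :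
    (coiter S n).op ((iter T n).op ((powMap E n Q).op x)) = (powMap E n Q).op x := by
  have hz : ∀ m (w : tensorPow E m R), (powMap E m S).op ((powMap E m Q).op w) = 0 := fun m w => by
    rw [← Intertwiner.comp_apply, ← powMap_comp]
    exact powMap_zero m hSQ w
  induction n using Nat.strong_induction_on with
  | _ n ih =>
    rcases Nat.eq_zero_or_pos n with rfl | hn
    · rfl
    obtain ⟨f, hf⟩ := hS n hn (hz n x)
    replace hf : (coiter S n).op f = (powMap E n Q).op x := hf
    have key : ∀ m ≤ n, (coiter S n).op ((iter T m).op ((coiter S m).op f)) =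
        (coiter S n).op f := by
      intro m
      induction m with
      | zero => intro _; rfl
      | succ m ihm =>
        intro hm
        -- The error at level `m < n` dies under `S⁽ᵐ⁺¹⁾`: by the strong induction hypothesis `S⁽ᵐ⁾`
        -- brings it back to a vector in the range of `I ⊗ Q`, which `I ⊗ S` annihilates.
        have h0 : (coiter S n).op ((iter T m).op ((powMap E m Q).op ((coiter S m).op f))) = 0 := by
          refine coiter_eq_zero_of_le hm ?_
          refine (congrArg (powMap E m S).op (ih m hm _)).trans (hz m _)
        have h1 := congrArg (coiter S n).op (iter_coiter_succ hTS m f)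
        rw [map_add, h0, add_zero, ihm (by omega)] at h1
        exact h1.symm
    rw [← hf]
    exact key n le_rfl

/-- Put `F = (I ⊗ Q) S⁽ⁿ⁾`, so that `F T_{n+1} = 0` by induction. At the next level the operator is
`(I_E ⊗ F) S T (I_E ⊗ T_{n+1})`. Replacing `S T z` by `z` costs an element of N(T) ⊆ E ⊗ R^∞(T), and
`I_E ⊗ F` kills it because `F` kills R(T_{n+1}). -/
lemma powMap_coiter_iter_succ (hQT : ∀ x, Q.op (T.op x) = 0)
    (hTST : ∀ x, T.op (S.op (T.op x)) = T.op x)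
    (hT : T.ker ≤ tensorSubspace E (genRange T)) (n : ℕ) (x : tensorPow E (n + 1) R) :
    (powMap E n Q).op ((coiter S n).op ((iter T (n + 1)).op x)) = 0 := by
  induction n with
  | zero => exact hQT x
  | succ n ih =>
    refine shift_injective n ?_
    refine (shift_powMap n Q _).trans ?_
    rw [shift_coiter, ← Intertwiner.comp_apply, ← interiorMap_comp]
    refine (congrArg (fun y => (interiorMap (E := E) _).op (S.op y))
      (iter_succ_eq_shift T (n + 1) x)).trans ?_
    set z := (interiorMap (iter T (n + 1))).op ((shift (n + 1) R).op x) with hz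
    set F := (powMap E n Q).comp (coiter S n) with hF
    have h1 : (interiorMap (E := E) F).op z = 0 := by
      rw [hz, ← Intertwiner.comp_apply, ← interiorMap_comp]
      -- `powMap E 1` unfolds to `interiorMap`.
      exact powMap_zero (E := E) 1 (f := F.comp (iter T (n + 1))) ih _
    have h2 : S.op (T.op z) - z ∈ tensorSubspace E (genRange T) := hT (by
      change T.op (S.op (T.op z) - z) = 0
      rw [map_sub, hTST, sub_self])
    have h3 : (interiorMap F).op (S.op (T.op z) - z) = 0 := by
      refine interiorMap_eq_zero (fun y hy => ?_) h2
      -- Of the whole generalized range only membership in R(T_{n+1}) is needed.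
      obtain ⟨w, rfl⟩ := (Submodule.mem_iInf _).1 hy (n + 1)
      exact ih w
    rwa [map_sub, h1, sub_zero] at h3

end Splitting

lemma isOrthogonalSum_of_eq_orthogonal {H : Type*} [NormedAddCommGroup H] [InnerProductSpace ℂ H]
    [CompleteSpace H] {M N : Submodule ℂ H} (hM : IsClosed (M : Set H)) (h : N = Mᗮ) :
    IsOrthogonalSum M N := by
  have : CompleteSpace M := hM.completeSpace_coe
  subst h
  exact ⟨Submodule.isOrtho_orthogonal_right M, Submodule.sup_orthogonal_of_hasOrthogonalProjection⟩

end Wold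

end CovariantRep

/-! ### The two orthogonal decompositions. -/

open CovariantRep in
theorem proposition3 {B : Type u} [NonUnitalCStarAlgebra B] [PartialOrder B] [StarOrderedRing B]
    {E : Type v} [NormedAddCommGroup E] [NormedSpace ℂ E] [CompleteSpace E] [SMul Bᵐᵒᵖ E]
    [CStarModule Bᵐᵒᵖ E] [CStarCorrespondence B E] {R : StarRep.{u, v} B} (π : CBCRep E R)
    (hπ : π.IsBiregular) :
    IsOrthogonalSum (generated π.tilde π.tilde.rangeᗮ) (genRange (cauchyDual π.tilde)) ∧
      IsOrthogonalSum (generated (cauchyDual π.tilde) π.tilde.rangeᗮ) (genRange π.tilde) := by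
  obtain ⟨⟨hcl, hker⟩, hS⟩ := hπ
  set T := π.tilde with hT
  have hMP : IsMoorePenrose T.op T.pinv.op :=
    Intertwiner.isMoorePenrose_pinv (exists_isMoorePenrose T.op hcl)
  rw [cauchyDual_eq_adjoint_pinv hMP]
  set S := T.pinv with hSdef
  have hTST : ∀ x, T.op (S.op (T.op x)) = T.op x := fun x => congr($(hMP.mul_mul_self) x)
  have hSTS : ∀ x, S.op (T.op (S.op x)) = S.op x := fun x => congr($(hMP.mul_mul_inv) x)
  have hsa : (T.comp S).adjoint = T.comp S :=
    Intertwiner.ext_apply fun x => congr($(hMP.adjoint_left) x)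
  obtain ⟨Q, hQ⟩ : ∃ Q, Q = (T.comp S).compl := ⟨_, rfl⟩
  have hQx : ∀ x, Q.op x = x - T.op (S.op x) := fun x => by rw [hQ]; rfl
  have hTS : ∀ x, x = T.op (S.op x) + Q.op x := fun x => by rw [hQx, add_sub_cancel]
  have hQT : ∀ x, Q.op (T.op x) = 0 := fun x => by rw [hQx, hTST, sub_self]
  have hSQ : ∀ x, S.op (Q.op x) = 0 := fun x => by rw [hQx, map_sub, hSTS, sub_self]
  have hQadj : Q.adjoint = Q := (Intertwiner.eq_adjoint fun x y => by
    have h := (T.comp S).adjoint_inner_left y x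
    rw [hsa] at h
    rw [hQx, hQx, inner_sub_left, inner_sub_right]
    exact congrArg (_ - ·) h).symm
  have hQQ : Q.comp Q = Q := Intertwiner.ext_apply fun x => by
    rw [Intertwiner.comp_apply]
    conv_lhs => rw [hQx, hSQ, map_zero, sub_zero]
  have hrange : T.rangeᗮ = Q.range := by
    ext x
    constructor
    · intro hx
      refine ⟨x, ?_⟩
      change Q.op x = x
      refine ext_inner_left ℂ fun y => ?_
      have h : ⟪T.op (S.op y), x⟫_ℂ = 0 := (Submodule.mem_orthogonal _ _).1 hx _ ⟨_, rfl⟩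
      rw [← Q.adjoint_inner_left, hQadj, hQx, inner_sub_left, h, sub_zero]
    · rintro ⟨x, rfl⟩
      rw [Submodule.mem_orthogonal]
      rintro _ ⟨y, rfl⟩
      change ⟪T.op y, Q.op x⟫_ℂ = 0
      rw [← Q.adjoint_inner_left, hQadj, hQT, inner_zero_left]
  -- The adjoint of `T S + Q = I`: the same splitting for the dual pair `(S*, T*)`, with the same
  -- `Q`.
  have hTS' : ∀ x, x = S.adjoint.op (T.adjoint.op x) + Q.op x := fun x => by
    rw [← Intertwiner.comp_apply, ← Intertwiner.adjoint_comp, hsa]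
    exact hTS x
  rw [hrange]
  refine ⟨isOrthogonalSum_of_eq_orthogonal (Submodule.isClosed_topologicalClosure _) ?_,
    isOrthogonalSum_of_eq_orthogonal (Submodule.isClosed_topologicalClosure _) ?_⟩
  · ext x
    rw [mem_orthogonal_generated T hQQ hQadj]
    constructor
    · intro hx n
      -- One level more than `n`: the extra factor becomes, in the adjoint, the `I ⊗ S` that
      -- annihilates `I ⊗ Q`.
      obtain ⟨y, rfl⟩ := (Submodule.mem_iInf _).1 hx (n + 1)
      refine ext_inner_right ℂ fun z => ?_
      change ⟪(powMap E n Q).op ((coiter T.adjoint n).op ((iter S.adjoint (n + 1)).op y)), z⟫_ℂ = _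
      -- The operator `(I ⊗ Q) T*⁽ⁿ⁾ S*_{n+1}` is the adjoint of `S⁽ⁿ⁺¹⁾ T_n (I ⊗ Q)`, so it is
      -- enough that the latter vanishes.
      have h : (coiter S (n + 1)).op ((iter T n).op ((powMap E n Q).op z)) = 0 := by
        refine (congrArg (powMap E n S).op (coiter_iter_powMap hTS hSQ hS n z)).trans ?_
        rw [← Intertwiner.comp_apply, ← powMap_comp]
        exact powMap_zero n hSQ z
      conv_lhs => rw [← congrArg (powMap E n) hQadj]
      rw [powMap_adjoint, Intertwiner.adjoint_inner_left, ← iter_adjoint,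
        Intertwiner.adjoint_inner_left, ← Intertwiner.adjoint_inner_right, iter_adjoint,
        Intertwiner.adjoint_adjoint, h, inner_zero_right, inner_zero_left]
    · intro hx
      exact (Submodule.mem_iInf _).2 fun n => ⟨_, iter_coiter_of_forall hTS' hx n⟩
  · ext x
    rw [mem_orthogonal_generated S.adjoint hQQ hQadj, Intertwiner.adjoint_adjoint]
    constructor
    · intro hx n
      obtain ⟨y, rfl⟩ := (Submodule.mem_iInf _).1 hx (n + 1)
      exact powMap_coiter_iter_succ hQT hTST hker n y
    · intro hx
      exact (Submodule.mem_iInf _).2 fun n => ⟨_, iter_coiter_of_forall hTS hx n⟩
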